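/- Let $\mathbb D$ be the open unit disc and $\mathbb T$ the unit circle. A bounded analytic function on $\mathbb D$ is inner if it has radial limits of modulus $1$ at almost every point of $\mathbb T$, and a singular inner function is an inner function without zeros in $\mathbb D$. The singular set of an inner function is the set of points of $\mathbb T$ across which it cannot be extended analytically. For an inner function $I$ with zero set $Z(I)\subset\mathbb D$, and with $\rho(z,w)=\left|\frac{z-w}{1-\overline w z}\right|$ and $\rho(z,Z(I))=\inf_{w\in Z(I)}\rho(z,w)$ (where $\inf\varnothing=+\infty$), we say that $I$ has the weak embedding property (WEP) if $$\inf\{|I(z)| : z\in\mathbb D,\ \rho(z,Z(I))>\varepsilon\}>0\qquad\text{for every }\varepsilon>0 .$$ A singular inner function $S$ is called easily wepable if there exist a constant $m<1$ and a (possibly finite or empty) Blaschke product $B$ such that $SB$ has the WEP and $Z(B)\subset\{z\in\mathbb D : |S(z)|<m\}$. A closed set $E\subset\mathbb T$ is called porous if there is a constant $C>0$ such that every arc $J\subset\mathbb T$ of positive length contains an arc $J'\subset J\setminus E$ with $|J'|>C|J|$. **Theorem.** Let $E$ be a closed subset of $\mathbb T$. The following conditions are equivalent: (a) Every singular inner function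 whose singular set is contained in $E$ is easily wepable. (b) The set $E$ is porous. -/

import Mathlib

open Metric Filter Topology
open scoped ENNReal ComplexConjugate

namespace Wepable

/-- The open unit disc. Functions on the disc are represented by total functions `ℂ → ℂ`, of which
only the values on the disc are ever used. -/
abbrev disc : Set ℂ := ball (0 : ℂ) 1

/-- The unit circle. -/
abbrev unitCircle : Set ℂ := sphere (0 : ℂ) 1

/-- The point of the unit circle with normalised parameter `t` (of period `1`). -/
noncomputable def circlePt (t : ℝ) : ℂ := Complex.exp (2 * Real.pi * t * Complex.I)

/-- `I` is an inner function: a bounded analytic function on the unit disc with radial limits of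
modulus `1` at almost every point of the unit circle. -/
def IsInner (I : ℂ → ℂ) : Prop :=
  DifferentiableOn ℂ I disc ∧
  (∃ M : ℝ, ∀ z ∈ disc, ‖I z‖ ≤ M) ∧
  ∀ᵐ t : ℝ, ∃ l : ℂ, ‖l‖ = 1 ∧
    Tendsto (fun r : ℝ => I ((r : ℂ) * circlePt t)) (𝓝[<] 1) (𝓝 l)

/-- The zero set of `I` in the unit disc. -/
def zeroSet (I : ℂ → ℂ) : Set ℂ := {z | z ∈ disc ∧ I z = 0}

/-- A singular inner function: an inner function without zeros in the unit disc. -/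
def IsSingularInner (S : ℂ → ℂ) : Prop := IsInner S ∧ zeroSet S = ∅

/-- The singular set of `I`: the points of the unit circle across which `I` has no analytic
extension. -/
def sing (I : ℂ → ℂ) : Set ℂ :=
  {ζ | ζ ∈ unitCircle ∧ ¬ ∃ g : ℂ → ℂ, AnalyticAt ℂ g ζ ∧ ∀ᶠ z in 𝓝[disc] ζ, g z = I z}

/-- The Blaschke factor with zero `a`. -/
noncomputable def blaschkeFactor (a z : ℂ) : ℂ :=
  if a = 0 then z else ((‖a‖ : ℂ) / a) * ((a - z) / (1 - conj a * z))

/-- `B` is the Blaschke product of a family of points `a i` of the disc, repeated according to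
multiplicity, with `∑ (1 - |a i|) < ∞`. This summability forces the family to be countable; it may
be infinite, finite or empty (the empty product is `1`). -/
def IsBlaschkeProduct (B : ℂ → ℂ) : Prop :=
  ∃ (ι : Type) (a : ι → ℂ), (∀ i, a i ∈ disc) ∧ Summable (fun i => 1 - ‖a i‖) ∧
    ∀ z ∈ disc, HasProd (fun i => blaschkeFactor (a i) z) (B z)

/-- The pseudohyperbolic distance on the unit disc. -/
noncomputable def rho (z w : ℂ) : ℝ := ‖(z - w) / (1 - conj w * z)‖

/-- The pseudohyperbolic distance from a point to a set, an infimum in `[0, ∞]`; the distance to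
the empty set is `∞`. -/
noncomputable def rhoSet (z : ℂ) (Z : Set ℂ) : ℝ≥0∞ := ⨅ w ∈ Z, ENNReal.ofReal (rho z w)

/-- `η_I(ε) = inf {|I(z)| : ρ(z, Z(I)) > ε}`, an infimum in `[0, ∞]`. -/
noncomputable def etaWEP (I : ℂ → ℂ) (ε : ℝ) : ℝ≥0∞ :=
  ⨅ z ∈ {z | z ∈ disc ∧ ENNReal.ofReal ε < rhoSet z (zeroSet I)}, ENNReal.ofReal ‖I z‖

/-- The weak embedding property. -/
def HasWEP (I : ℂ → ℂ) : Prop := ∀ ε : ℝ, 0 < ε → 0 < etaWEP I ε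

/-- `S` is easily wepable. -/
def IsEasilyWepable (S : ℂ → ℂ) : Prop :=
  ∃ m : ℝ, m < 1 ∧ ∃ B : ℂ → ℂ, IsBlaschkeProduct B ∧ HasWEP (fun z => S z * B z) ∧
    zeroSet B ⊆ {z | z ∈ disc ∧ ‖S z‖ < m}

/-- `J` is an arc of the unit circle of normalised length `ℓ > 0`. Each endpoint may belong to `J`
or not, and the whole circle is an arc (of length `1`). -/
def IsArc (J : Set ℂ) (ℓ : ℝ) : Prop :=
  0 < ℓ ∧ ℓ ≤ 1 ∧ ∃ a : ℝ,
    circlePt '' Set.Ioo a (a + ℓ) ⊆ J ∧ J ⊆ circlePt '' Set.Icc a (a + ℓ)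

/-- Porosity of a subset of the unit circle. -/
def IsPorous (E : Set ℂ) : Prop :=
  ∃ C : ℝ, 0 < C ∧ ∀ (J : Set ℂ) (ℓ : ℝ), IsArc J ℓ →
    ∃ (J' : Set ℂ) (ℓ' : ℝ), IsArc J' ℓ' ∧ J' ⊆ J \ E ∧ C * ℓ < ℓ'

end Wepable

namespace Wepable

/-! ### Möbius maps, the Poisson kernel and the pseudohyperbolic distance -/

/-! Write u = -log|S|, a nonnegative harmonic function whose boundary mass sits on the singular set.

Porous implies wepable. Choose zeros where u is large: for each j take a maximal 2^(-j)-separated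
set Z_j in U_j = {u > M^(2pj)}, and let B have all the Z_j as zeros. A point z with ρ(z, Z(SB)) > ε
lies outside U_j once 2^(-j) < ε, so u(z) is bounded and |S(z)| is bounded below. It remains to
bound |B(z)| below, that is, to bound the sum of 1 - ρ(z,a)^2 over the zeros a by a constant
depending only on a bound K for u(z). Porosity can be phrased conformally invariantly (`MobPorous`),
so z may be moved to the origin. Harnack's inequality (`IsSingularInner.log_le`) then says that a
point where u is huge is very close to the circle and lies in a tangential region, |x - a|^2 ≤ K(1 -
|a|^2), at some x of the moved set. A porous set is covered by (M-1)^k arcs of length M^(-k)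
(`MobPorous.exists_cover`), so the separated points with 1 - |a|^2 of order M^(-2k) contribute at
most a constant times 4^j(1 - 1/M)^k (`sum_gap_le`). Only large k occur for large j, and the
exponent p makes this decay beat the factor 4^j (`IsSingularInner.sum_gap_mob_le`).

Wepable implies porous. If E is not porous, it is nearly dense in arcs shrinking to a point
(`exists_accumulation_of_not_isPorous`). Evenly spread atoms on the k-th arc make u ≥ k + 1 on N
dyadic levels of points below the arc, while u is O(1/(k + 1)) near a point z_k at distance A·l from
the circle, A times the length l of the arc (`exists_singularInner_of_not_isPorous`). If SB had the
WEP, B would have a zero near every point of this net. Each level lowers log|B(z_k)| by at least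
1/(18A), so N levels make B(z_k) tiny (`norm_le_exp_of_net`). The WEP then forces a further zero of
B near z_k, where |S| is close to 1, against Z(B) ⊂ {|S| < m}. -/

/-- The Möbius automorphism of the disc which sends `z` to the origin. -/
noncomputable def mob (z w : ℂ) : ℂ := (w - z) / (1 - conj z * w)

/-- The quantity `1 - |a|²`. -/
noncomputable def gap (a : ℂ) : ℝ := 1 - ‖a‖ ^ 2

/-- The Poisson kernel of the disc at `w` with pole `x`. -/
noncomputable def pker (w x : ℂ) : ℝ := gap w / ‖x - w‖ ^ 2

lemma mem_disc {z : ℂ} : z ∈ disc ↔ ‖z‖ < 1 := by simp [disc]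

lemma mem_unitCircle {z : ℂ} : z ∈ unitCircle ↔ ‖z‖ = 1 := by simp [unitCircle]

lemma gap_pos {a : ℂ} (ha : a ∈ disc) : 0 < gap a := by
  have := mem_disc.1 ha
  unfold gap; nlinarith [norm_nonneg a]

lemma gap_le_one (a : ℂ) : gap a ≤ 1 := by
  unfold gap; nlinarith [norm_nonneg a]

lemma one_sub_norm_le_gap {a : ℂ} (ha : ‖a‖ ≤ 1) : 1 - ‖a‖ ≤ gap a := by
  unfold gap; nlinarith [norm_nonneg a]

lemma gap_le_two_mul (a : ℂ) : gap a ≤ 2 * (1 - ‖a‖) := by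
  unfold gap; nlinarith [sq_nonneg (1 - ‖a‖)]

lemma one_sub_conj_mul_ne_zero {z w : ℂ} (hz : z ∈ disc) (hw : ‖w‖ ≤ 1) :
    1 - conj z * w ≠ 0 := by
  intro h
  have h1 : conj z * w = 1 := (sub_eq_zero.1 h).symm
  have h2 : ‖conj z * w‖ = 1 := by rw [h1]; simp
  rw [norm_mul, RCLike.norm_conj] at h2
  have := mem_disc.1 hz
  nlinarith [norm_nonneg z, norm_nonneg w]

lemma norm_one_sub_conj_mul_sq (a b : ℂ) :
    ‖1 - conj b * a‖ ^ 2 = ‖a - b‖ ^ 2 + gap a * gap b := by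
  unfold gap
  simp only [Complex.sq_norm, Complex.normSq_apply, Complex.sub_re, Complex.sub_im,
    Complex.mul_re, Complex.mul_im, Complex.conj_re, Complex.conj_im, Complex.one_re,
    Complex.one_im]
  ring

lemma norm_one_sub_conj_mul_of_norm_eq_one {z x : ℂ} (hx : ‖x‖ = 1) :
    ‖1 - conj z * x‖ = ‖x - z‖ := by
  have h := norm_one_sub_conj_mul_sq x z
  have h0 : gap x = 0 := by simp [gap, hx]
  rw [h0, zero_mul, add_zero] at h
  exact (sq_eq_sq₀ (norm_nonneg _) (norm_nonneg _)).1 h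

lemma norm_mob_sub_mob {z a b : ℂ} (hz : z ∈ disc) (ha : ‖a‖ ≤ 1) (hb : ‖b‖ ≤ 1) :
    ‖mob z a - mob z b‖ = ‖a - b‖ * gap z / (‖1 - conj z * a‖ * ‖1 - conj z * b‖) := by
  have ha' := one_sub_conj_mul_ne_zero hz ha
  have hb' := one_sub_conj_mul_ne_zero hz hb
  have h : mob z a - mob z b
      = (a - b) * (gap z : ℝ) / ((1 - conj z * a) * (1 - conj z * b)) := by
    have hg : ((gap z : ℝ) : ℂ) = 1 - conj z * z := by
      rw [Complex.conj_mul']; simp [gap]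
    unfold mob
    rw [hg, div_sub_div _ _ ha' hb']
    congr 1
    ring
  rw [h, norm_div, norm_mul, norm_mul, Complex.norm_real, Real.norm_of_nonneg (gap_pos hz).le]

lemma gap_mob {z a : ℂ} (hz : z ∈ disc) (ha : ‖a‖ ≤ 1) :
    gap (mob z a) = gap z * gap a / ‖1 - conj z * a‖ ^ 2 := by
  have ha' := norm_ne_zero_iff.2 (one_sub_conj_mul_ne_zero hz ha)
  have h := norm_one_sub_conj_mul_sq a z
  have : gap (mob z a) = 1 - ‖a - z‖ ^ 2 / ‖1 - conj z * a‖ ^ 2 := by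
    rw [gap, mob, norm_div, div_pow]
  rw [this, eq_div_iff (by positivity), sub_mul, div_mul_cancel₀ _ (by positivity), h]
  ring

lemma mob_mem_disc {z a : ℂ} (hz : z ∈ disc) (ha : a ∈ disc) : mob z a ∈ disc := by
  have ha1 := (mem_disc.1 ha).le
  have h := gap_mob hz ha1
  have : 0 < gap (mob z a) := by
    rw [h]
    have := norm_pos_iff.2 (one_sub_conj_mul_ne_zero hz ha1)
    have := gap_pos hz
    have := gap_pos ha
    positivity
  rw [mem_disc]
  unfold gap at this
  nlinarith [norm_nonneg (mob z a)]

lemma norm_mob_eq_one {z x : ℂ} (hz : z ∈ disc) (hx : ‖x‖ = 1) : ‖mob z x‖ = 1 := by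
  have h := gap_mob hz hx.le
  have h0 : gap x = 0 := by simp [gap, hx]
  rw [h0, mul_zero, zero_div] at h
  unfold gap at h
  have : ‖mob z x‖ ^ 2 = 1 := by linarith
  exact (pow_eq_one_iff_of_nonneg (norm_nonneg _) two_ne_zero).1 this

lemma mob_surj {z v : ℂ} (hz : z ∈ disc) (hv : v ∈ disc) : ∃ w ∈ disc, mob z w = v := by
  have hz' : -z ∈ disc := by simpa [mem_disc] using hz
  refine ⟨mob (-z) v, mob_mem_disc hz' hv, ?_⟩
  have h1 := one_sub_conj_mul_ne_zero hz' (mem_disc.1 hv).le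
  have h2 := one_sub_conj_mul_ne_zero hz (mem_disc.1 (mob_mem_disc hz' hv)).le
  have h3 := one_sub_conj_mul_ne_zero hz (mem_disc.1 hz).le
  have h4 : (1 : ℂ) + conj z * v ≠ 0 := by simpa using h1
  have e : mob (-z) v = (v + z) / (1 + conj z * v) := by simp [mob]
  rw [e] at h2 ⊢
  unfold mob
  rw [div_eq_iff h2, mul_sub, mul_one, ← mul_div_assoc, ← mul_div_assoc, sub_eq_sub_iff_add_eq_add,
    div_add' _ _ _ h4, div_eq_iff h4, add_mul, div_mul_cancel₀ _ h4]
  ring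

lemma rho_eq_norm_mob (z w : ℂ) : rho z w = ‖mob w z‖ := rfl

lemma rho_nonneg (z w : ℂ) : 0 ≤ rho z w := norm_nonneg _

lemma one_sub_rho_sq (z w : ℂ) : 1 - rho z w ^ 2 = gap (mob w z) := rfl

lemma rho_lt_one {z w : ℂ} (hz : z ∈ disc) (hw : w ∈ disc) : rho z w < 1 :=
  mem_disc.1 (mob_mem_disc hw hz)

lemma norm_one_sub_conj_mul_comm (a b : ℂ) : ‖1 - conj b * a‖ = ‖1 - conj a * b‖ := by
  rw [← RCLike.norm_conj (1 - conj b * a)]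
  congr 1
  simp [mul_comm]

lemma rho_comm (z w : ℂ) : rho z w = rho w z := by
  unfold rho
  rw [norm_div, norm_div, norm_sub_rev, norm_one_sub_conj_mul_comm]

lemma rho_eq_zero_iff {z w : ℂ} (hz : z ∈ disc) (hw : w ∈ disc) : rho z w = 0 ↔ z = w := by
  unfold rho
  rw [norm_eq_zero, div_eq_zero_iff, or_iff_left (one_sub_conj_mul_ne_zero hw (mem_disc.1 hz).le),
    sub_eq_zero]

lemma one_sub_rho_sq_eq {z w : ℂ} (hz : z ∈ disc) (hw : w ∈ disc) :
    1 - rho z w ^ 2 = gap w * gap z / ‖1 - conj w * z‖ ^ 2 := by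
  rw [one_sub_rho_sq, gap_mob hw (mem_disc.1 hz).le]

/-- The quotient |z - w|^2 / (gap z · gap w) equals ρ^2/(1 - ρ^2), so it is Möbius invariant and
dominates ρ^2. It is the measure of separation used throughout. -/
lemma rho_lt_of_norm_sub_sq_lt {z w : ℂ} (hz : z ∈ disc) (hw : w ∈ disc) {δ : ℝ} (hδ : 0 ≤ δ)
    (h : ‖z - w‖ ^ 2 < δ ^ 2 * (gap z * gap w)) : rho z w < δ := by
  have hp := norm_pos_iff.2 (one_sub_conj_mul_ne_zero hw (mem_disc.1 hz).le)
  unfold rho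
  rw [norm_div, div_lt_iff₀ hp]
  have h1 := norm_one_sub_conj_mul_sq z w
  refine lt_of_pow_lt_pow_left₀ 2 (by positivity) ?_
  rw [mul_pow, h1]
  nlinarith [sq_nonneg (‖z - w‖), sq_nonneg δ, mul_nonneg (sq_nonneg δ) (sq_nonneg (‖z - w‖))]

lemma norm_sub_pos_of_norm_eq_one {w x : ℂ} (hw : w ∈ disc) (hx : ‖x‖ = 1) : 0 < ‖x - w‖ := by
  rw [norm_pos_iff, sub_ne_zero]
  rintro rfl
  exact absurd (mem_disc.1 hw) (by simp [hx])

lemma pker_pos {w x : ℂ} (hw : w ∈ disc) (hx : ‖x‖ = 1) : 0 < pker w x :=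
  div_pos (gap_pos hw) (pow_pos (norm_sub_pos_of_norm_eq_one hw hx) 2)

lemma one_sub_norm_le_norm_sub {w x : ℂ} (hx : ‖x‖ = 1) : 1 - ‖w‖ ≤ ‖x - w‖ := by
  have := norm_sub_norm_le x w
  rwa [hx] at this

lemma pker_le {w x : ℂ} (hw : w ∈ disc) (hx : ‖x‖ = 1) :
    pker w x ≤ (1 + ‖w‖) / (1 - ‖w‖) := by
  have h1 := one_sub_norm_le_norm_sub (w := w) hx
  have h2 : 0 < 1 - ‖w‖ := sub_pos.2 (mem_disc.1 hw)
  have h3 := norm_nonneg w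
  unfold pker
  calc gap w / ‖x - w‖ ^ 2 ≤ gap w / (1 - ‖w‖) ^ 2 := by
        have := (gap_pos hw).le
        gcongr
    _ = _ := by unfold gap; field_simp; ring

lemma pker_le_four_div {w x : ℂ} (hw : w ∈ disc) (hx : ‖x‖ = 1) : pker w x ≤ 4 / gap w := by
  have h1 := one_sub_norm_le_norm_sub (w := w) hx
  have h4 := gap_le_two_mul w
  have h5 := gap_pos hw
  have h6 : 0 < ‖x - w‖ := norm_sub_pos_of_norm_eq_one hw hx
  unfold pker
  rw [div_le_div_iff₀ (by positivity) h5]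
  nlinarith

/-- Change of variables for harmonic measure: it reduces a comparison of the kernels at w and z to
an estimate of one kernel after z has been moved to the origin. -/
lemma pker_mob {z w x : ℂ} (hz : z ∈ disc) (hw : w ∈ disc) (hx : ‖x‖ = 1) :
    pker w x = pker (mob z w) (mob z x) * pker z x := by
  have h1 := norm_sub_pos_of_norm_eq_one hz hx
  have h2 := norm_sub_pos_of_norm_eq_one hw hx
  have h3 := norm_pos_iff.2 (one_sub_conj_mul_ne_zero hz (mem_disc.1 hw).le)
  have h4 := gap_pos hz
  unfold pker
  rw [norm_mob_sub_mob hz hx.le (mem_disc.1 hw).le, gap_mob hz (mem_disc.1 hw).le,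
    norm_one_sub_conj_mul_of_norm_eq_one hx]
  generalize ‖1 - conj z * w‖ = d at *
  field_simp

/-- Harnack's inequality for the Poisson kernel. -/
lemma pker_le_three_mul {z w x : ℂ} (hz : z ∈ disc) (hw : w ∈ disc) (hx : ‖x‖ = 1)
    (h : rho w z ≤ 1 / 2) : pker w x ≤ 3 * pker z x := by
  rw [pker_mob hz hw hx]
  refine mul_le_mul_of_nonneg_right ?_ (pker_pos hz hx).le
  refine (pker_le (mob_mem_disc hz hw) (norm_mob_eq_one hz hx)).trans ?_
  rw [rho_eq_norm_mob] at h
  rw [div_le_iff₀ (by linarith)]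
  linarith

/-! ### Blaschke products -/

lemma norm_blaschkeFactor (a z : ℂ) : ‖blaschkeFactor a z‖ = rho z a := by
  unfold blaschkeFactor rho
  split_ifs with h
  · simp [h]
  · rw [norm_mul, norm_div, Complex.norm_real, norm_norm, div_self (norm_ne_zero_iff.2 h), one_mul,
      norm_div, norm_div, norm_sub_rev]

lemma blaschkeFactor_self (a : ℂ) : blaschkeFactor a a = 0 := by
  unfold blaschkeFactor
  split_ifs with h <;> simp [h]

lemma norm_blaschkeFactor_sub_one_le {a z : ℂ} (ha : a ∈ disc) (hz : z ∈ disc) :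
    ‖blaschkeFactor a z - 1‖ ≤ 4 * (1 - ‖a‖) / (1 - ‖z‖) := by
  have hz1 : 0 < 1 - ‖z‖ := sub_pos.2 (mem_disc.1 hz)
  have ha1 : 0 < 1 - ‖a‖ := sub_pos.2 (mem_disc.1 ha)
  have hd : 1 - ‖z‖ ≤ ‖1 - conj a * z‖ := by
    have h := norm_sub_norm_le (1 : ℂ) (conj a * z)
    rw [norm_mul, RCLike.norm_conj, norm_one] at h
    nlinarith [norm_nonneg z, norm_nonneg a]
  rw [le_div_iff₀ hz1]
  rcases le_or_gt (1 / 2) ‖a‖ with h | h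
  · have ha0 : a ≠ 0 := by
      rintro rfl
      norm_num at h
    have hn := one_sub_conj_mul_ne_zero ha (mem_disc.1 hz).le
    have e : blaschkeFactor a z - 1
        = -((a + ‖a‖ * z) * ((1 - ‖a‖ : ℝ) : ℂ)) / (a * (1 - conj a * z)) := by
      unfold blaschkeFactor
      rw [if_neg ha0, div_mul_div_comm, div_sub_one (mul_ne_zero ha0 hn)]
      congr 1
      have := Complex.mul_conj' a
      push_cast
      linear_combination z * this
    rw [e, norm_div, norm_neg, norm_mul, norm_mul, Complex.norm_real, Real.norm_of_nonneg ha1.le]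
    have h2 : ‖a + ‖a‖ * z‖ ≤ 2 * ‖a‖ := by
      refine (norm_add_le _ _).trans ?_
      rw [norm_mul, Complex.norm_real, norm_norm]
      nlinarith [norm_nonneg a, mem_disc.1 hz]
    have h3 : 0 < ‖a‖ := by linarith
    have h4 : 0 < ‖1 - conj a * z‖ := by linarith
    rw [div_mul_eq_mul_div, div_le_iff₀ (by positivity)]
    have h5 : ‖a + ‖a‖ * z‖ * (1 - ‖a‖) * (1 - ‖z‖) ≤ 2 * ‖a‖ * (1 - ‖a‖) * (1 - ‖z‖) := by gcongr
    have h6 : 2 * ‖a‖ * (1 - ‖a‖) * (1 - ‖z‖) ≤ 2 * ‖a‖ * (1 - ‖a‖) * ‖1 - conj a * z‖ := by gcongr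
    have h7 : 0 ≤ ‖a‖ * (1 - ‖a‖) * ‖1 - conj a * z‖ := by positivity
    linarith
  · have h2 : ‖blaschkeFactor a z - 1‖ ≤ 2 := by
      refine (norm_sub_le _ _).trans ?_
      rw [norm_blaschkeFactor, norm_one]
      linarith [rho_lt_one hz ha]
    nlinarith [norm_nonneg z]

lemma multipliable_blaschkeFactor {ι : Type} {a : ι → ℂ} (ha : ∀ i, a i ∈ disc)
    (hs : Summable fun i => 1 - ‖a i‖) {z : ℂ} (hz : z ∈ disc) :
    Multipliable fun i => blaschkeFactor (a i) z := by
  have h : Summable fun i => ‖blaschkeFactor (a i) z - 1‖ := by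
    refine Summable.of_nonneg_of_le (fun i => norm_nonneg _)
      (fun i => norm_blaschkeFactor_sub_one_le (ha i) hz) ?_
    exact (hs.mul_left 4).div_const _
  simpa using multipliable_one_add_of_summable h

/-- From log x ≥ 1 - 1/x at x = ρ^2. Together with `le_exp_half` it makes log|B| comparable to the
sum of 1 - ρ^2 over the zeros, as long as ρ stays away from 0. -/
lemma exp_le_rho {z w : ℂ} {ε : ℝ} (hε : 0 < ε) (h : ε ≤ rho z w) (h1 : rho z w ≤ 1) :
    Real.exp (-((1 - rho z w ^ 2) / (2 * ε ^ 2))) ≤ rho z w := by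
  have hp : 0 < rho z w := hε.trans_le h
  rw [← Real.le_log_iff_exp_le hp]
  have h2 := Real.one_sub_inv_le_log_of_pos (pow_pos hp 2)
  rw [Real.log_pow] at h2
  push_cast at h2
  have h3 : (rho z w ^ 2)⁻¹ - 1 ≤ (1 - rho z w ^ 2) / ε ^ 2 := by
    have : (rho z w ^ 2)⁻¹ - 1 = (1 - rho z w ^ 2) / rho z w ^ 2 := by field_simp
    rw [this]
    have h4 : 0 ≤ 1 - rho z w ^ 2 := by nlinarith
    gcongr
  have h6 : (1 - rho z w ^ 2) / (2 * ε ^ 2) = (1 - rho z w ^ 2) / ε ^ 2 / 2 := by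
    field_simp
  rw [h6]
  linarith

/-- A lower bound for a Blaschke product away from its zeros. -/
lemma exp_le_norm_of_hasProd {ι : Type} {a : ι → ℂ} (ha : ∀ i, a i ∈ disc) {z B : ℂ}
    (hz : z ∈ disc) {ε C : ℝ} (hε : 0 < ε)
    (hB : HasProd (fun i => blaschkeFactor (a i) z) B) (hr : ∀ i, ε ≤ rho z (a i))
    (hC : ∀ s : Finset ι, ∑ i ∈ s, (1 - rho z (a i) ^ 2) ≤ C) :
    Real.exp (-(C / (2 * ε ^ 2))) ≤ ‖B‖ := by
  refine ge_of_tendsto' hB.norm fun s => ?_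
  have h7 : Real.exp (-(C / (2 * ε ^ 2)))
      ≤ ∏ i ∈ s, Real.exp (-((1 - rho z (a i) ^ 2) / (2 * ε ^ 2))) := by
    rw [← Real.exp_sum, Real.exp_le_exp, Finset.sum_neg_distrib, ← Finset.sum_div]
    have := hC s
    gcongr
  refine h7.trans (Finset.prod_le_prod (fun i _ => (Real.exp_pos _).le) fun i hi => ?_)
  rw [norm_blaschkeFactor]
  exact exp_le_rho hε (hr i) (rho_lt_one hz (ha i)).le

/-- A Blaschke product is bounded by any of its finite partial products. -/
lemma norm_le_prod_rho {ι : Type} {a : ι → ℂ} (ha : ∀ i, a i ∈ disc) {z B : ℂ}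
    (hz : z ∈ disc) (hB : HasProd (fun i => blaschkeFactor (a i) z) B) (s : Finset ι) :
    ‖B‖ ≤ ∏ i ∈ s, rho z (a i) := by
  refine le_of_tendsto hB.norm ?_
  filter_upwards [Filter.eventually_ge_atTop s] with t ht
  simp only [norm_blaschkeFactor]
  exact Finset.prod_le_prod_of_subset_of_le_one ht (fun i _ => rho_nonneg _ _)
    fun i _ _ => (rho_lt_one hz (ha i)).le

lemma gap_mob_le {z a : ℂ} (hz : z ∈ disc) (ha : a ∈ disc) :
    gap (mob a z) ≤ 2 / (1 - ‖z‖) ^ 2 * (1 - ‖a‖) := by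
  have hz1 : 0 < 1 - ‖z‖ := sub_pos.2 (mem_disc.1 hz)
  have ha1 : 0 < 1 - ‖a‖ := sub_pos.2 (mem_disc.1 ha)
  rw [gap_mob ha (mem_disc.1 hz).le]
  have hd : 1 - ‖z‖ ≤ ‖1 - conj a * z‖ := by
    have h := norm_sub_norm_le (1 : ℂ) (conj a * z)
    rw [norm_mul, RCLike.norm_conj, norm_one] at h
    nlinarith [norm_nonneg z, norm_nonneg a]
  have h1 := gap_le_two_mul a
  have h2 := gap_le_one z
  have h3 := gap_pos hz
  have h4 := gap_pos ha
  calc gap a * gap z / ‖1 - conj a * z‖ ^ 2 ≤ (2 * (1 - ‖a‖)) * 1 / (1 - ‖z‖) ^ 2 := by gcongr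
    _ = _ := by ring

/-- A convergent Blaschke product vanishes only at the points of its family. -/
lemma exists_eq_of_hasProd_zero {ι : Type} {a : ι → ℂ} (ha : ∀ i, a i ∈ disc)
    (hs : Summable fun i => 1 - ‖a i‖) {z : ℂ} (hz : z ∈ disc)
    (hB : HasProd (fun i => blaschkeFactor (a i) z) 0) : ∃ i, a i = z := by
  classical
  by_contra! hne
  have hgs : Summable fun i => 1 - rho z (a i) ^ 2 := by
    refine Summable.of_nonneg_of_le (fun i => ?_) (fun i => gap_mob_le hz (ha i)) (hs.mul_left _)
    rw [one_sub_rho_sq]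
    exact (gap_pos (mob_mem_disc (ha i) hz)).le
  -- Outside this finite set ρ > 1/2, so a positive lower bound for all the ρ is a minimum over
  -- finitely many positive numbers.
  have hfin : {i | ¬ 1 - rho z (a i) ^ 2 < 3 / 4}.Finite := by
    have := hgs.tendsto_cofinite_zero.eventually_lt_const (show (0 : ℝ) < 3 / 4 by norm_num)
    simpa [Filter.eventually_cofinite] using this
  obtain ⟨ε, hε, hεle⟩ : ∃ ε > 0, ∀ i, ε ≤ rho z (a i) := by
    have hpos : ∀ i, 0 < rho z (a i) := fun i => lt_of_le_of_ne (rho_nonneg _ _)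
      fun h => hne i ((rho_eq_zero_iff hz (ha i)).1 h.symm).symm
    obtain ⟨ε, hε, h⟩ : ∃ ε > 0, ∀ i ∈ hfin.toFinset, ε ≤ rho z (a i) := by
      induction hfin.toFinset using Finset.induction_on with
      | empty => exact ⟨1, one_pos, by simp⟩
      | insert i s _ ih =>
        obtain ⟨ε, hε, h⟩ := ih
        refine ⟨min ε (rho z (a i)), lt_min hε (hpos i), fun j hj => ?_⟩
        rcases Finset.mem_insert.1 hj with rfl | hj
        · exact min_le_right _ _
        · exact (min_le_left _ _).trans (h j hj)
    refine ⟨min ε (1 / 2), lt_min hε (by norm_num), fun i => ?_⟩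
    by_cases hi : i ∈ hfin.toFinset
    · exact (min_le_left _ _).trans (h i hi)
    · refine (min_le_right _ _).trans ?_
      simp only [Set.Finite.mem_toFinset, Set.mem_ofPred_eq, not_not] at hi
      nlinarith [hpos i]
  have := exp_le_norm_of_hasProd ha hz hε hB hεle (C := ∑' i, (1 - rho z (a i) ^ 2)) fun s =>
    hgs.sum_le_tsum s fun i _ => by
      rw [one_sub_rho_sq]
      exact (gap_pos (mob_mem_disc (ha i) hz)).le
  rw [norm_zero] at this
  exact absurd this (not_le.2 (Real.exp_pos _))

/-! ### The parametrisation of the circle -/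

lemma norm_circlePt (t : ℝ) : ‖circlePt t‖ = 1 := by
  have : circlePt t = Complex.exp ((2 * Real.pi * t : ℝ) * Complex.I) := by
    simp [circlePt]
  rw [this, Complex.norm_exp_ofReal_mul_I]

lemma circlePt_add_int (t : ℝ) (n : ℤ) : circlePt (t + n) = circlePt t := by
  unfold circlePt
  rw [Complex.exp_eq_exp_iff_exists_int]
  exact ⟨n, by push_cast; ring⟩

lemma continuous_circlePt : Continuous circlePt := by unfold circlePt; fun_prop

lemma exists_circlePt_eq {ξ : ℂ} (hξ : ‖ξ‖ = 1) (t₀ : ℝ) :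
    ∃ t, |t - t₀| ≤ 1 / 2 ∧ circlePt t = ξ := by
  have h1 : circlePt (ξ.arg / (2 * Real.pi)) = ξ := by
    have := Complex.norm_mul_exp_arg_mul_I ξ
    rw [hξ, Complex.ofReal_one, one_mul] at this
    refine Eq.trans ?_ this
    unfold circlePt
    congr 1
    have : (Real.pi : ℂ) ≠ 0 := by exact_mod_cast Real.pi_ne_zero
    push_cast
    field_simp
  refine ⟨ξ.arg / (2 * Real.pi) + (-round (ξ.arg / (2 * Real.pi) - t₀) : ℤ), ?_, ?_⟩
  · have := abs_sub_round (ξ.arg / (2 * Real.pi) - t₀)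
    rwa [Int.cast_neg, ← sub_eq_add_neg, sub_right_comm]
  · rw [circlePt_add_int, h1]

lemma norm_circlePt_sub (s t : ℝ) :
    ‖circlePt s - circlePt t‖ = 2 * |Real.sin (Real.pi * (s - t))| := by
  have h : circlePt s - circlePt t
      = circlePt t * (Complex.exp (Complex.I * (2 * Real.pi * (s - t) : ℝ)) - 1) := by
    unfold circlePt
    rw [mul_sub, ← Complex.exp_add, mul_one]
    congr 2
    push_cast
    ring
  rw [h, norm_mul, norm_circlePt, one_mul, Complex.norm_exp_I_mul_ofReal_sub_one, norm_mul]
  simp only [Real.norm_eq_abs, abs_two]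
  congr 3
  ring

lemma norm_circlePt_sub_le (s t : ℝ) : ‖circlePt s - circlePt t‖ ≤ 7 * |s - t| := by
  rw [norm_circlePt_sub]
  have h1 : |Real.sin (Real.pi * (s - t))| ≤ |Real.pi * (s - t)| := Real.abs_sin_le_abs
  rw [abs_mul, abs_of_pos Real.pi_pos] at h1
  nlinarith [Real.pi_lt_d2, abs_nonneg (s - t)]

lemma le_norm_circlePt_sub {s t : ℝ} (h : |s - t| ≤ 1 / 2) :
    4 * |s - t| ≤ ‖circlePt s - circlePt t‖ := by
  rw [norm_circlePt_sub]
  have h1 : Real.sin (Real.pi * |s - t|) ≤ |Real.sin (Real.pi * (s - t))| := by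
    rcases abs_cases (s - t) with ⟨h, _⟩ | ⟨h, _⟩ <;> rw [h]
    · exact le_abs_self _
    · rw [mul_neg, Real.sin_neg]; exact neg_le_abs _
  have h2 : 2 / Real.pi * (Real.pi * |s - t|) ≤ Real.sin (Real.pi * |s - t|) :=
    Real.mul_le_sin (by positivity) (by nlinarith [Real.pi_pos])
  have h3 : 2 / Real.pi * (Real.pi * |s - t|) = 2 * |s - t| := by
    have := Real.pi_ne_zero
    field_simp
  linarith

lemma exists_eq_norm_mul_circlePt (v : ℂ) : ∃ t, v = (‖v‖ : ℂ) * circlePt t := by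
  by_cases hv : v = 0
  · exact ⟨0, by simp [hv]⟩
  · have h : ‖v / ‖v‖‖ = 1 := by
      rw [norm_div, Complex.norm_real, norm_norm, div_self (norm_ne_zero_iff.2 hv)]
    obtain ⟨t, _, ht⟩ := exists_circlePt_eq h 0
    refine ⟨t, ?_⟩
    rw [ht, mul_div_cancel₀]
    exact_mod_cast norm_ne_zero_iff.2 hv

lemma norm_circlePt_sub_mul {r : ℝ} (hr : r ≤ 1) (t : ℝ) :
    ‖circlePt t - r * circlePt t‖ = 1 - r := by
  have : circlePt t - r * circlePt t = ((1 - r : ℝ) : ℂ) * circlePt t := by push_cast; ring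
  rw [this, norm_mul, norm_circlePt, mul_one, Complex.norm_real, Real.norm_of_nonneg (by linarith)]

lemma norm_mul_circlePt {r : ℝ} (hr : 0 ≤ r) (t : ℝ) : ‖(r : ℂ) * circlePt t‖ = r := by
  rw [norm_mul, norm_circlePt, mul_one, Complex.norm_real, Real.norm_of_nonneg hr]

/-! ### A conformally invariant form of porosity -/

/-- A form of porosity which is invariant under the automorphisms of the disc. -/
def MobPorous (c : ℝ) (F : Set ℂ) : Prop :=
  ∀ v ∈ disc, ∃ ξ : ℂ, ‖ξ‖ = 1 ∧ ∀ x ∈ F, c * ‖x - v‖ * ‖ξ - v‖ ≤ ‖x - ξ‖ * gap v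

/-- Dividing the inequality in `MobPorous` by |x - v||ξ - v| turns it into |mob v x - mob v ξ| ≥ c:
seen from any v, the set misses an arc of fixed size. Porosity at the scale 1 - |v| near v/|v|
provides it. -/
lemma IsPorous.exists_mobPorous {E : Set ℂ} (hE : E ⊆ unitCircle) (h : IsPorous E) :
    ∃ c, 0 < c ∧ c ≤ 1 ∧ MobPorous c E := by
  obtain ⟨C, hC, h⟩ := h
  have hc : 0 < 5 * (1 + 5 / (2 * C)) := by positivity
  refine ⟨1 / (5 * (1 + 5 / (2 * C))), by positivity, ?_, fun v hv => ?_⟩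
  · rw [div_le_one hc]
    have : 0 < 5 / (2 * C) := by positivity
    linarith
  obtain ⟨t₀, ht₀⟩ := exists_eq_norm_mul_circlePt v
  have hv1 := mem_disc.1 hv
  set l := 1 - ‖v‖ with hl
  have hl0 : 0 < l := sub_pos.2 hv1
  have hl1 : l ≤ 1 := by linarith [norm_nonneg v]
  have hcv : ‖circlePt t₀ - v‖ = l := by
    conv_lhs => rw [ht₀]
    exact norm_circlePt_sub_mul hv1.le t₀
  -- The arc has length 1 - |v| and is centred at the radial projection of v. The midpoint of its
  -- free subarc serves as ξ, so every point of E is at distance at least 2C(1 - |v|) from ξ.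
  obtain ⟨J', l', ⟨hl'0, hl'1, a, ha, _⟩, hJ', hlt⟩ :=
    h (circlePt '' Set.Ioo (t₀ - l / 2) (t₀ - l / 2 + l)) l ⟨hl0, hl1, t₀ - l / 2, subset_rfl,
      Set.image_mono Set.Ioo_subset_Icc_self⟩
  have hmid : circlePt (a + l' / 2) ∈ J' := ha ⟨a + l' / 2, ⟨by linarith, by linarith⟩, rfl⟩
  refine ⟨circlePt (a + l' / 2), norm_circlePt _, fun x hx => ?_⟩
  have hξ : ‖circlePt (a + l' / 2) - v‖ ≤ 5 * l := by
    obtain ⟨t', ⟨h1, h2⟩, h3⟩ := (hJ' hmid).1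
    rw [← h3]
    have h4 := norm_circlePt_sub_le t' t₀
    have h5 : |t' - t₀| ≤ l / 2 := abs_le.2 ⟨by linarith, by linarith⟩
    have := norm_sub_le_norm_sub_add_norm_sub (circlePt t') (circlePt t₀) v
    linarith
  obtain ⟨s, hs, rfl⟩ := exists_circlePt_eq (mem_unitCircle.1 (hE hx)) (a + l' / 2)
  have hfar : 2 * C * l ≤ ‖circlePt s - circlePt (a + l' / 2)‖ := by
    have h1 := le_norm_circlePt_sub hs
    have h2 : l' / 2 ≤ |s - (a + l' / 2)| := by
      by_contra! hlt
      rw [abs_lt] at hlt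
      exact (hJ' (ha ⟨s, ⟨by linarith, by linarith⟩, rfl⟩)).2 hx
    linarith
  set y := ‖circlePt s - circlePt (a + l' / 2)‖ with hy
  have h1 : ‖circlePt s - v‖ ≤ y + 5 * l :=
    (norm_sub_le_norm_sub_add_norm_sub _ (circlePt (a + l' / 2)) _).trans (by linarith)
  have h2 : ‖circlePt s - v‖ ≤ y * (1 + 5 / (2 * C)) := by
    have : 5 * l ≤ y * (5 / (2 * C)) := by
      rw [mul_div_assoc', le_div_iff₀ (by positivity)]
      linarith
    linarith
  have h3 := one_sub_norm_le_gap hv1.le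
  have hy0 : 0 ≤ y := norm_nonneg _
  rw [mul_assoc, one_div, inv_mul_le_iff₀ hc]
  calc ‖circlePt s - v‖ * ‖circlePt (a + l' / 2) - v‖
      ≤ (y * (1 + 5 / (2 * C))) * (5 * l) := by gcongr
    _ = 5 * (1 + 5 / (2 * C)) * (y * l) := by ring
    _ ≤ _ := by gcongr

/-- Both sides are multiplied by the same factor under an automorphism, so the constant c does not
change. -/
lemma MobPorous.image {c : ℝ} {F : Set ℂ} (hF : F ⊆ unitCircle) (h : MobPorous c F) {z : ℂ}
    (hz : z ∈ disc) : MobPorous c (mob z '' F) := by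
  intro v hv
  obtain ⟨w, hw, rfl⟩ := mob_surj hz hv
  obtain ⟨ξ, hξ, hx⟩ := h w hw
  refine ⟨mob z ξ, norm_mob_eq_one hz hξ, ?_⟩
  rintro _ ⟨x, hxF, rfl⟩
  have hx1 := mem_unitCircle.1 (hF hxF)
  have hw1 := (mem_disc.1 hw).le
  have h1 := norm_pos_iff.2 (one_sub_conj_mul_ne_zero hz hx1.le)
  have h2 := norm_pos_iff.2 (one_sub_conj_mul_ne_zero hz hξ.le)
  have h3 := norm_pos_iff.2 (one_sub_conj_mul_ne_zero hz hw1)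
  have hg := gap_pos hz
  rw [norm_mob_sub_mob hz hx1.le hw1, norm_mob_sub_mob hz hξ.le hw1,
    norm_mob_sub_mob hz hx1.le hξ.le, gap_mob hz hw1]
  have := hx x hxF
  generalize ‖1 - conj z * x‖ = p at *
  generalize ‖1 - conj z * ξ‖ = q at *
  generalize ‖1 - conj z * w‖ = r at *
  calc c * (‖x - w‖ * gap z / (p * r)) * (‖ξ - w‖ * gap z / (q * r))
      = (c * ‖x - w‖ * ‖ξ - w‖) * (gap z ^ 2 / (p * q * r ^ 2)) := by field_simp
    _ ≤ (‖x - ξ‖ * gap w) * (gap z ^ 2 / (p * q * r ^ 2)) := by gcongr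
    _ = _ := by field_simp

/-- Every arc contains a proportional arc which is free of the set. -/
lemma MobPorous.exists_free_interval {c : ℝ} (hc : 0 < c) (hc1 : c ≤ 1) {F : Set ℂ}
    (h : MobPorous c F) (a : ℝ) {l : ℝ} (hl : 0 < l) (hl1 : l ≤ 1) :
    ∃ s, a ≤ s ∧ s + c ^ 2 * l / 256 ≤ a + l ∧
      ∀ t ∈ Set.Icc s (s + c ^ 2 * l / 256), circlePt t ∉ F := by
  set y := c * l / 16 with hy
  have hy0 : 0 < y := by positivity
  have hcl : c * l ≤ l := by nlinarith
  have hccl : c ^ 2 * l ≤ l := by nlinarith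
  have hccl0 : 0 < c ^ 2 * l := by positivity
  have hy1 : 0 ≤ 1 - y := by linarith
  set v : ℂ := ((1 - y : ℝ) : ℂ) * circlePt (a + l / 2) with hv
  have hvn : ‖v‖ = 1 - y := norm_mul_circlePt hy1 _
  have hvd : v ∈ disc := by rw [mem_disc, hvn]; linarith
  have hmv : ‖circlePt (a + l / 2) - v‖ = y := by
    rw [hv, norm_circlePt_sub_mul (by linarith)]; ring
  have hgap : gap v ≤ 2 * y := (gap_le_two_mul v).trans (by rw [hvn]; linarith)
  obtain ⟨ξ, hξ, hx⟩ := h v hvd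
  -- If ξ is far from v, a point of F near the left end would satisfy cXD ≤ 2y(X + D) with both X
  -- and D large against y/c, which is impossible; so the left end is free. If ξ is near, it lies
  -- over the middle half of the arc, and the interval starting at ξ is free because the factor 14
  -- coming from the chord and gap bounds is less than 16.
  rcases le_or_gt (8 * y / c) ‖ξ - v‖ with hD | hD
  · refine ⟨a, le_rfl, by linarith, fun t ht htF => ?_⟩
    have h1 := hx _ htF
    have h2 : ‖circlePt t - ξ‖ ≤ ‖circlePt t - v‖ + ‖ξ - v‖ := by
      rw [norm_sub_rev ξ v]
      exact norm_sub_le_norm_sub_add_norm_sub _ _ _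
    have h3 : 4 * |t - (a + l / 2)| ≤ ‖circlePt t - circlePt (a + l / 2)‖ :=
      le_norm_circlePt_sub (abs_le.2 ⟨by linarith [ht.1], by linarith [ht.2]⟩)
    have h4 : l / 4 ≤ |t - (a + l / 2)| := by
      rw [abs_sub_comm]
      exact le_trans (by linarith [ht.2]) (le_abs_self _)
    have h5 : ‖circlePt t - circlePt (a + l / 2)‖ ≤ ‖circlePt t - v‖ + y := by
      rw [← hmv, norm_sub_rev (circlePt (a + l / 2)) v]
      exact norm_sub_le_norm_sub_add_norm_sub _ _ _
    rw [div_le_iff₀ hc] at hD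
    set X := ‖circlePt t - v‖
    set D := ‖ξ - v‖
    have hX : l - y ≤ X := by linarith
    have hX0 : 0 ≤ X := norm_nonneg _
    have hD0 : 0 < D := by nlinarith
    have h6 : c * X * D ≤ (X + D) * (2 * y) :=
      h1.trans (mul_le_mul h2 hgap (gap_pos hvd).le (by positivity))
    have h7 : X * (8 * y) ≤ X * (D * c) := by gcongr
    have h8 : (3 / 4 * (c * X) - 2 * y) * D ≤ 0 := by nlinarith
    have h9 : 3 / 4 * (c * X) - 2 * y ≤ 0 := by
      by_contra! hcon
      exact absurd h8 (not_le.2 (mul_pos hcon hD0))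
    have h10 : c * (l - y) ≤ c * X := by gcongr
    nlinarith
  · have hD' : ‖ξ - v‖ < l / 2 := by
      have : 8 * y / c = l / 2 := by rw [hy]; field_simp; ring
      linarith
    obtain ⟨τ, hτ, rfl⟩ := exists_circlePt_eq hξ (a + l / 2)
    have h1 := le_norm_circlePt_sub hτ
    have h2 : ‖circlePt τ - circlePt (a + l / 2)‖ ≤ ‖circlePt τ - v‖ + y := by
      rw [← hmv, norm_sub_rev (circlePt (a + l / 2)) v]
      exact norm_sub_le_norm_sub_add_norm_sub _ _ _
    have h3 : |τ - (a + l / 2)| ≤ l / 4 := by linarith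
    rw [abs_le] at h3
    refine ⟨τ, by linarith, by linarith, fun t ht htF => ?_⟩
    have h4 := hx _ htF
    have h5 := norm_circlePt_sub_le t τ
    have h6 : |t - τ| ≤ c ^ 2 * l / 256 := abs_le.2 ⟨by linarith [ht.1], by linarith [ht.2]⟩
    have h7 := one_sub_norm_le_norm_sub (w := v) (norm_circlePt t)
    have h8 := one_sub_norm_le_norm_sub (w := v) (norm_circlePt τ)
    rw [hvn, sub_sub_cancel] at h7 h8
    have h9 : c * y * y ≤ (7 * (c ^ 2 * l / 256)) * (2 * y) := by
      calc c * y * y ≤ c * ‖circlePt t - v‖ * ‖circlePt τ - v‖ := by gcongr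
        _ ≤ _ := h4
        _ ≤ _ := mul_le_mul (h5.trans (by linarith)) hgap (gap_pos hvd).le (by positivity)
    have h10 : c * y * y = (16 * (c ^ 2 * l / 256)) * y := by rw [hy]; ring
    have : 0 < (c ^ 2 * l / 256) * y := by positivity
    nlinarith

/-- Among the `M` equal parts of an arc, one is free of the set. -/
lemma MobPorous.exists_free_part {c : ℝ} (hc : 0 < c) (hc1 : c ≤ 1) {F : Set ℂ}
    (h : MobPorous c F) {M : ℕ} (hM : 512 / c ^ 2 ≤ M) (a : ℝ) {l : ℝ} (hl : 0 < l) (hl1 : l ≤ 1) :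
    ∃ j < M, ∀ t ∈ Set.Icc (a + j * (l / M)) (a + j * (l / M) + l / M), circlePt t ∉ F := by
  obtain ⟨s, hs, hsl, hfree⟩ := h.exists_free_interval hc hc1 a hl hl1
  have hc2 : 0 < c ^ 2 := by positivity
  have hM0 : (0 : ℝ) < M := lt_of_lt_of_le (by positivity) hM
  set d := l / M with hd
  have hd0 : 0 < d := by positivity
  -- A free interval of length at least 2d contains a whole cell of the grid of step d; this is the
  -- source of 512.
  have hd1 : 2 * d ≤ c ^ 2 * l / 256 := by
    rw [div_le_iff₀ hc2] at hM
    rw [hd, mul_div_assoc', div_le_div_iff₀ hM0 (by norm_num)]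
    nlinarith
  set j := ⌈(s - a) / d⌉₊ with hj
  have hnn : 0 ≤ (s - a) / d := div_nonneg (by linarith) hd0.le
  have h1 : s - a ≤ j * d := by
    have := Nat.le_ceil ((s - a) / d)
    rwa [div_le_iff₀ hd0] at this
  have h2 : j * d < s - a + d := by
    have := Nat.ceil_lt_add_one hnn
    have h3 : ((s - a) / d + 1) * d = s - a + d := by field_simp
    rw [← h3]
    gcongr
  refine ⟨j, ?_, fun t ht => hfree t ⟨by linarith [ht.1], by linarith [ht.2]⟩⟩
  have h3 : (j : ℝ) * d < M * d := by
    have : (M : ℝ) * d = l := by rw [hd]; field_simp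
    linarith
  exact_mod_cast lt_of_mul_lt_mul_right h3 hd0.le

/-- A porous set is covered by `(M - 1) ^ k` arcs of length `M ^ (-k)`. -/
lemma MobPorous.exists_cover {c : ℝ} (hc : 0 < c) (hc1 : c ≤ 1) {F : Set ℂ}
    (hF : F ⊆ unitCircle) (h : MobPorous c F) {M : ℕ} (hM : 512 / c ^ 2 ≤ M) (k : ℕ) :
    ∃ L : Finset ℝ, L.card ≤ (M - 1) ^ k ∧
      ∀ x ∈ F, ∃ a ∈ L, ∃ t ∈ Set.Icc a (a + 1 / (M : ℝ) ^ k), circlePt t = x := by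
  have hc2 : 0 < c ^ 2 := by positivity
  have hM0 : (0 : ℝ) < M := lt_of_lt_of_le (by positivity) hM
  have hM1 : 1 ≤ M := by exact_mod_cast hM0
  have hM1' : (1 : ℝ) ≤ M := by exact_mod_cast hM1
  induction k with
  | zero =>
    refine ⟨{0}, by simp, fun x hx => ⟨0, by simp, ?_⟩⟩
    obtain ⟨t, ht, rfl⟩ := exists_circlePt_eq (mem_unitCircle.1 (hF hx)) (1 / 2)
    rw [abs_le] at ht
    exact ⟨t, ⟨by linarith, by simp; linarith⟩, rfl⟩
  | succ k ih =>
    classical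
    obtain ⟨L, hL, hcov⟩ := ih
    have hl0 : 0 < 1 / (M : ℝ) ^ k := by positivity
    have hl1 : 1 / (M : ℝ) ^ k ≤ 1 := by
      rw [div_le_one (by positivity)]
      exact one_le_pow₀ hM1'
    choose j hjM hj using fun a => h.exists_free_part hc hc1 hM a hl0 hl1
    have hdiv : 1 / (M : ℝ) ^ k / M = 1 / (M : ℝ) ^ (k + 1) := by rw [pow_succ]; field_simp
    simp only [hdiv] at hj
    set d := 1 / (M : ℝ) ^ (k + 1) with hd
    have hd0 : 0 < d := by positivity
    have hMd : M * d = 1 / (M : ℝ) ^ k := by rw [hd, pow_succ]; field_simp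
    -- Each arc of generation k is cut into M parts and the free part is dropped.
    refine ⟨L.biUnion fun a => ((Finset.range M).erase (j a)).image fun i : ℕ => a + i * d, ?_, ?_⟩
    · refine Finset.card_biUnion_le.trans
        ((Finset.sum_le_card_nsmul _ _ (M - 1) fun a _ => ?_).trans ?_)
      · refine Finset.card_image_le.trans ?_
        rw [Finset.card_erase_of_mem (Finset.mem_range.2 (hjM a)), Finset.card_range]
      · rw [smul_eq_mul, pow_succ]
        gcongr
    · intro x hx
      obtain ⟨a, ha, t, ht, rfl⟩ := hcov x hx
      obtain ⟨i, hi, hti⟩ : ∃ i < M, t ∈ Set.Icc (a + (i : ℕ) * d) (a + i * d + d) := by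
        by_cases hend : t < a + 1 / (M : ℝ) ^ k
        · have hnn : 0 ≤ (t - a) / d := div_nonneg (by linarith [ht.1]) hd0.le
          refine ⟨⌊(t - a) / d⌋₊, ?_, ?_, ?_⟩
          · rw [Nat.floor_lt hnn, div_lt_iff₀ hd0, hMd]
            linarith
          · have := Nat.floor_le hnn
            rw [le_div_iff₀ hd0] at this
            linarith
          · have := (Nat.lt_floor_add_one ((t - a) / d)).le
            rw [div_le_iff₀ hd0] at this
            linarith
        -- The right endpoint of the arc, for which the floor would give the index M, belongs to the
        -- last closed part.
        · refine ⟨M - 1, by omega, ?_, ?_⟩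
          · push_cast [Nat.cast_sub hM1]
            nlinarith
          · push_cast [Nat.cast_sub hM1]
            nlinarith [ht.2]
      refine ⟨a + i * d, ?_, t, hti, rfl⟩
      simp only [Finset.mem_biUnion, Finset.mem_image, Finset.mem_erase, Finset.mem_range]
      refine ⟨a, ha, i, ⟨?_, hi⟩, rfl⟩
      rintro rfl
      exact hj a t hti hx

/-! ### Counting separated points close to a porous set -/

/-- Separated points of a thin sector at the circle are counted by a square grid. -/
lemma card_le_of_separated {p : ℂ} (hp : ‖p‖ = 1) {A R r : ℝ} (hA : 1 ≤ A) (hR : 0 < R)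
    (hr : 0 < r) (Z : Finset ℂ) (hZ : ∀ a ∈ Z, a ∈ disc) (hnear : ∀ a ∈ Z, ‖a - p‖ ≤ A * R)
    (hgap : ∀ a ∈ Z, gap a ≤ R ^ 2)
    (hsep : ∀ a ∈ Z, ∀ b ∈ Z, a ≠ b → 2 * r ≤ ‖a - b‖) :
    (Z.card : ℝ) ≤ (2 * (1 + A ^ 2) * R ^ 2 / r + 1) * (2 * (A * R / r) + 2) := by
  -- After rotating p to 1, the map records the cell of a grid of side r. Cells have diameter √2·r <
  -- 2r, so each holds at most one point, and the sector is only of order R^2 thick in the radial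
  -- direction.
  set f : ℂ → ℤ × ℤ := fun a => (⌊(1 - (a * conj p).re) / r⌋, ⌊(a * conj p).im / r⌋) with hf
  set X := 2 * (1 + A ^ 2) * R ^ 2 / r with hX
  set Y := A * R / r with hY
  have hX0 : 0 ≤ X := by positivity
  have hY0 : 0 ≤ Y := by positivity
  have hinj : Set.InjOn f Z := by
    intro a ha b hb hab
    by_contra hne
    have h1 := hsep a ha b hb hne
    simp only [hf, Prod.mk.injEq] at hab
    have h2 := Int.abs_sub_lt_one_of_floor_eq_floor hab.1
    have h3 := Int.abs_sub_lt_one_of_floor_eq_floor hab.2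
    rw [← sub_div, abs_div, abs_of_pos hr, div_lt_one hr] at h2 h3
    have h4 : ‖a - b‖ = ‖a * conj p - b * conj p‖ := by
      rw [← sub_mul, norm_mul, RCLike.norm_conj, hp, mul_one]
    have h5 : ‖a - b‖ ^ 2 < 2 * r ^ 2 := by
      rw [h4, Complex.sq_norm, Complex.normSq_apply, Complex.sub_re, Complex.sub_im]
      have h6 := sq_lt_sq' (by linarith [abs_lt.1 h2]) (abs_lt.1 h2).2
      have h7 := sq_lt_sq' (by linarith [abs_lt.1 h3]) (abs_lt.1 h3).2
      nlinarith
    nlinarith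
  have hmaps : ∀ a ∈ Z, f a ∈ Finset.Icc (0 : ℤ) ⌊X⌋ ×ˢ Finset.Icc ⌊-Y⌋ ⌊Y⌋ := by
    intro a ha
    have hb1 : ‖a * conj p‖ < 1 := by
      rw [norm_mul, RCLike.norm_conj, hp, mul_one]; exact mem_disc.1 (hZ a ha)
    have hb2 : gap (a * conj p) ≤ R ^ 2 := by
      have : gap (a * conj p) = gap a := by
        simp [gap, hp]
      rw [this]; exact hgap a ha
    have hb3 : ‖a * conj p - 1‖ ≤ A * R := by
      have : a * conj p - 1 = (a - p) * conj p := by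
        rw [sub_mul, Complex.mul_conj', hp]; simp
      rw [this, norm_mul, RCLike.norm_conj, hp, mul_one]
      exact hnear a ha
    simp only [hf, Finset.mem_product, Finset.mem_Icc]
    generalize a * conj p = b at *
    have him : |b.im| ≤ A * R := by
      have := Complex.abs_im_le_norm (b - 1)
      simp only [Complex.sub_im, Complex.one_im, sub_zero] at this
      linarith
    have hre : |b.re| ≤ ‖b‖ := Complex.abs_re_le_norm b
    have hre' := abs_le.1 hre
    have him' := abs_le.1 him
    have hnorm : ‖b‖ ^ 2 = b.re * b.re + b.im * b.im := by
      rw [Complex.sq_norm, Complex.normSq_apply]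
    have hupper : 1 - b.re ≤ 2 * (1 + A ^ 2) * R ^ 2 := by
      rcases le_or_gt 0 b.re with h0 | h0
      · unfold gap at hb2
        have h1 : b.im ^ 2 ≤ (A * R) ^ 2 := sq_le_sq' him'.1 him'.2
        nlinarith [sq_nonneg R, sq_nonneg (A * R)]
      -- A negative real part forces AR > 1, whence AR ≤ (AR)^2 and the bound holds trivially.
      · have h1 := Complex.abs_re_le_norm (b - 1)
        simp only [Complex.sub_re, Complex.one_re] at h1
        have h2 : 1 - b.re ≤ A * R := by
          rw [abs_sub_comm] at h1
          exact (le_abs_self _).trans (h1.trans hb3)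
        nlinarith [sq_nonneg R]
    refine ⟨⟨?_, ?_⟩, ?_, ?_⟩
    · exact Int.floor_nonneg.2 (div_nonneg (by linarith) hr.le)
    · refine Int.floor_le_floor ?_
      rw [hX]; gcongr
    · refine Int.floor_le_floor ?_
      rw [hY, ← neg_div]; gcongr; linarith
    · refine Int.floor_le_floor ?_
      rw [hY]; gcongr; linarith
  have hcard := Finset.card_le_card_of_injOn f hmaps hinj
  rw [Finset.card_product, Int.card_Icc, Int.card_Icc] at hcard
  have hcard' : (Z.card : ℝ) ≤ ((⌊X⌋ + 1 - 0).toNat : ℝ) * ((⌊Y⌋ + 1 - ⌊-Y⌋).toNat : ℝ) := by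
    exact_mod_cast hcard
  refine hcard'.trans ?_
  have hx : ((⌊X⌋ + 1 - 0).toNat : ℝ) ≤ X + 1 := by
    have h0 : 0 ≤ ⌊X⌋ := Int.floor_nonneg.2 hX0
    have h1 : (((⌊X⌋ + 1 - 0).toNat : ℤ) : ℝ) = ((⌊X⌋ + 1 - 0 : ℤ) : ℝ) := by
      rw [Int.toNat_of_nonneg (by omega)]
    rw [← Int.cast_natCast, h1]
    push_cast
    linarith [Int.floor_le X]
  have hy : ((⌊Y⌋ + 1 - ⌊-Y⌋).toNat : ℝ) ≤ 2 * Y + 2 := by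
    have h0 : ⌊-Y⌋ ≤ ⌊Y⌋ := Int.floor_le_floor (by linarith)
    have h1 : (((⌊Y⌋ + 1 - ⌊-Y⌋).toNat : ℤ) : ℝ) = ((⌊Y⌋ + 1 - ⌊-Y⌋ : ℤ) : ℝ) := by
      rw [Int.toNat_of_nonneg (by omega)]
    rw [← Int.cast_natCast, h1]
    push_cast
    linarith [Int.floor_le Y, Int.lt_floor_add_one (-Y)]
  exact mul_le_mul hx hy (by positivity) (by positivity)

/-- The constant in the counting estimates. -/
noncomputable def countConst (M : ℕ) (B : ℝ) : ℝ :=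
  (2 * (2 * (1 + (B + 7) ^ 2)) * M ^ 2 + 1) * (4 * (B + 7) * M ^ 2 + 2)

lemma countConst_pos (M : ℕ) {B : ℝ} (hB : 0 ≤ B) : 0 < countConst M B := by
  unfold countConst; positivity

/-- Each of the (M-1)^k covering arcs of length R = M^(-k) carries a region of size about R by R^2
holding these points. Their mutual distance is at least of order δR^2, so a region holds O(δ^(-2)/R)
of them. -/
lemma card_level_le {c : ℝ} (hc : 0 < c) (hc1 : c ≤ 1) {F : Set ℂ}
    (hF : F ⊆ unitCircle) (h : MobPorous c F) {M : ℕ} (hM : 512 / c ^ 2 ≤ M) {B δ : ℝ}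
    (hB : 0 ≤ B) (hδ : 0 < δ) (hδ1 : δ ≤ 1) (Z : Finset ℂ) (hZ : ∀ a ∈ Z, a ∈ disc)
    (hnear : ∀ a ∈ Z, ∃ x ∈ F, ‖x - a‖ ^ 2 ≤ B ^ 2 * gap a)
    (hsep : ∀ a ∈ Z, ∀ b ∈ Z, a ≠ b → δ ^ 2 * (gap a * gap b) ≤ ‖a - b‖ ^ 2) (k : ℕ)
    (hlow : ∀ a ∈ Z, ((1 / (M : ℝ)) ^ 2) ^ (k + 1) < gap a)
    (hupp : ∀ a ∈ Z, gap a ≤ ((1 / (M : ℝ)) ^ 2) ^ k) :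
    (Z.card : ℝ) ≤ ((M - 1 : ℕ) : ℝ) ^ k * M ^ k * (countConst M B / δ ^ 2) := by
  classical
  have hM0 : (0 : ℝ) < M := lt_of_lt_of_le (by positivity) hM
  have hM1 : 1 ≤ M := by exact_mod_cast hM0
  have hM1' : (1 : ℝ) ≤ M := by exact_mod_cast hM1
  obtain ⟨L, hL, hcov⟩ := h.exists_cover hc hc1 hF hM k
  set R : ℝ := 1 / (M : ℝ) ^ k with hR
  have hR0 : 0 < R := by positivity
  have hR1 : R ≤ 1 := by
    rw [hR, div_le_one (by positivity)]
    exact one_le_pow₀ hM1'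
  have e1 : ((1 / (M : ℝ)) ^ 2) ^ k = R ^ 2 := by rw [hR, ← one_div_pow]; ring
  have e2 : ((1 / (M : ℝ)) ^ 2) ^ (k + 1) = (R / M) ^ 2 := by rw [hR, ← one_div_pow]; ring
  rw [e1] at hupp
  rw [e2] at hlow
  -- Both gaps exceed (R/M)^2, so the separation hypothesis gives a distance of at least δ(R/M)^2 =
  -- 2r.
  set r := δ * R ^ 2 / (2 * M ^ 2) with hr
  have hr0 : 0 < r := by positivity
  have hsub : Z ⊆ L.biUnion fun t => Z.filter fun a => ‖a - circlePt t‖ ≤ (B + 7) * R := by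
    intro a ha
    obtain ⟨x, hxF, hx⟩ := hnear a ha
    obtain ⟨t, ht, s, hs, rfl⟩ := hcov x hxF
    simp only [Finset.mem_biUnion, Finset.mem_filter]
    refine ⟨t, ht, ha, ?_⟩
    have h1 : ‖circlePt s - a‖ ≤ B * R := by
      refine abs_le_of_sq_le_sq' ?_ (by positivity) |>.2
      refine hx.trans ?_
      rw [mul_pow]
      have := hupp a ha
      gcongr
    have h2 := norm_circlePt_sub_le s t
    have h3 : |s - t| ≤ R := abs_le.2 ⟨by linarith [hs.1], by linarith [hs.2]⟩
    have h4 := norm_sub_le_norm_sub_add_norm_sub a (circlePt s) (circlePt t)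
    rw [norm_sub_rev a (circlePt s)] at h4
    linarith
  have hone : ∀ t ∈ L, ((Z.filter fun a => ‖a - circlePt t‖ ≤ (B + 7) * R).card : ℝ)
      ≤ M ^ k * (countConst M B / δ ^ 2) := by
    intro t _
    refine (card_le_of_separated (norm_circlePt t) (A := B + 7) (by linarith) hR0 hr0 _
      (fun a ha => hZ a (Finset.mem_filter.1 ha).1) (fun a ha => (Finset.mem_filter.1 ha).2)
      (fun a ha => hupp a (Finset.mem_filter.1 ha).1) ?_).trans ?_
    · intro a ha b hb hab
      have ha' := (Finset.mem_filter.1 ha).1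
      have hb' := (Finset.mem_filter.1 hb).1
      have h1 := hsep a ha' b hb' hab
      have h2 := hlow a ha'
      have h3 := hlow b hb'
      refine abs_le_of_sq_le_sq' ?_ (norm_nonneg _) |>.2
      refine le_trans ?_ h1
      have e3 : (2 * r) ^ 2 = δ ^ 2 * ((R / M) ^ 2 * (R / M) ^ 2) := by
        rw [hr]; field_simp
      rw [e3]
      gcongr
      exact (gap_pos (hZ a ha')).le
    · have h1 : 2 * (1 + (B + 7) ^ 2) * R ^ 2 / r + 1
          ≤ (2 * (2 * (1 + (B + 7) ^ 2)) * M ^ 2 + 1) / δ := by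
        have : 2 * (1 + (B + 7) ^ 2) * R ^ 2 / r = 2 * (2 * (1 + (B + 7) ^ 2)) * M ^ 2 / δ := by
          rw [hr]; field_simp
        rw [this, add_div]
        gcongr
        rwa [le_div_iff₀ hδ, one_mul]
      have h2 : 2 * ((B + 7) * R / r) + 2 ≤ (4 * (B + 7) * M ^ 2 + 2) / (δ * R) := by
        have : 2 * ((B + 7) * R / r) = 4 * (B + 7) * M ^ 2 / (δ * R) := by
          rw [hr]; field_simp; ring
        rw [this, add_div]
        gcongr
        rw [le_div_iff₀ (by positivity)]
        nlinarith
      refine (mul_le_mul h1 h2 (by positivity) (by positivity)).trans (le_of_eq ?_)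
      unfold countConst
      rw [hR]
      field_simp
  calc (Z.card : ℝ)
      ≤ ∑ t ∈ L, ((Z.filter fun a => ‖a - circlePt t‖ ≤ (B + 7) * R).card : ℝ) := by
        exact_mod_cast (Finset.card_le_card hsub).trans Finset.card_biUnion_le
    _ ≤ L.card • (M ^ k * (countConst M B / δ ^ 2)) := Finset.sum_le_card_nsmul _ _ _ hone
    _ ≤ _ := by
        rw [nsmul_eq_mul, mul_assoc]
        have : (L.card : ℝ) ≤ ((M - 1 : ℕ) : ℝ) ^ k := by exact_mod_cast hL
        have := (countConst_pos M hB).le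
        gcongr

/-- The sum of the gaps of a separated family of points close to a porous set. -/
lemma sum_gap_le {c : ℝ} (hc : 0 < c) (hc1 : c ≤ 1) {F : Set ℂ}
    (hF : F ⊆ unitCircle) (h : MobPorous c F) {M : ℕ} (hM : 512 / c ^ 2 ≤ M) {B δ : ℝ}
    (hB : 0 ≤ B) (hδ : 0 < δ) (hδ1 : δ ≤ 1) (Z : Finset ℂ) (hZ : ∀ a ∈ Z, a ∈ disc)
    (hnear : ∀ a ∈ Z, ∃ x ∈ F, ‖x - a‖ ^ 2 ≤ B ^ 2 * gap a)
    (hsep : ∀ a ∈ Z, ∀ b ∈ Z, a ≠ b → δ ^ 2 * (gap a * gap b) ≤ ‖a - b‖ ^ 2) (k₀ : ℕ)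
    (hupp : ∀ a ∈ Z, gap a ≤ ((1 / (M : ℝ)) ^ 2) ^ k₀) :
    ∑ a ∈ Z, gap a ≤ countConst M B / δ ^ 2 * ((1 - 1 / (M : ℝ)) ^ k₀ * M) := by
  classical
  have hM2' : (2 : ℝ) ≤ M := by
    refine le_trans ?_ hM
    rw [le_div_iff₀ (by positivity)]
    nlinarith
  have hM0 : (0 : ℝ) < M := by linarith
  have hM1 : 1 ≤ M := by exact_mod_cast hM0
  have hy0 : 0 < 1 / (M : ℝ) := by positivity
  have hy1 : 1 / (M : ℝ) < 1 := by rw [div_lt_one hM0]; linarith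
  have hex : ∀ a, ∃ k : ℕ, a ∈ Z →
      ((1 / (M : ℝ)) ^ 2) ^ (k + 1) < gap a ∧ gap a ≤ ((1 / (M : ℝ)) ^ 2) ^ k := by
    intro a
    by_cases ha : a ∈ Z
    · obtain ⟨k, hk⟩ := exists_nat_pow_near_of_lt_one (gap_pos (hZ a ha)) (gap_le_one a)
        (pow_pos hy0 2) (pow_lt_one₀ hy0.le hy1 two_ne_zero)
      exact ⟨k, fun _ => hk⟩
    · exact ⟨0, fun h => absurd h ha⟩
  choose lev hlev using hex
  have hlev0 : ∀ a ∈ Z, k₀ ≤ lev a := by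
    intro a ha
    by_contra! hlt
    have h1 := (hlev a ha).1
    have h2 := hupp a ha
    have h3 : ((1 / (M : ℝ)) ^ 2) ^ k₀ ≤ ((1 / (M : ℝ)) ^ 2) ^ (lev a + 1) :=
      pow_le_pow_of_le_one (by positivity) (pow_le_one₀ hy0.le hy1.le) hlt
    linarith
  set q := 1 - 1 / (M : ℝ) with hq
  have hq0 : 0 ≤ q := by linarith
  have hCδ : 0 ≤ countConst M B / δ ^ 2 := by
    have := countConst_pos M hB
    positivity
  -- The count ((M-1)M)^k times the gap M^(-2k) is (1 - 1/M)^k: porosity is exactly what makes the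
  -- sum over levels geometric.
  have hlevel : ∀ k, ∑ a ∈ Z with lev a = k, gap a ≤ countConst M B / δ ^ 2 * q ^ k := by
    intro k
    have h1 : ∀ a ∈ Z.filter (lev · = k), gap a ≤ ((1 / (M : ℝ)) ^ 2) ^ k := by
      intro a ha
      obtain ⟨haZ, rfl⟩ := Finset.mem_filter.1 ha
      exact (hlev a haZ).2
    have h2 := card_level_le hc hc1 hF h hM hB hδ hδ1 (Z.filter (lev · = k))
      (fun a ha => hZ a (Finset.mem_filter.1 ha).1)
      (fun a ha => hnear a (Finset.mem_filter.1 ha).1)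
      (fun a ha b hb => hsep a (Finset.mem_filter.1 ha).1 b (Finset.mem_filter.1 hb).1) k
      (by
        intro a ha
        obtain ⟨haZ, rfl⟩ := Finset.mem_filter.1 ha
        exact (hlev a haZ).1) h1
    refine (Finset.sum_le_card_nsmul _ _ _ h1).trans ?_
    rw [nsmul_eq_mul]
    calc _ ≤ (((M - 1 : ℕ) : ℝ) ^ k * M ^ k * (countConst M B / δ ^ 2)) *
          ((1 / (M : ℝ)) ^ 2) ^ k := by gcongr
      _ = countConst M B / δ ^ 2 * ((((M - 1 : ℕ) : ℝ) * M * (1 / M) ^ 2)) ^ k := by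
        rw [mul_pow, mul_pow]; ring
      _ = _ := by
        congr 2
        rw [Nat.cast_sub hM1, hq]
        field_simp
        simp
  have hmaps : ∀ a ∈ Z, lev a ∈ Finset.Ico k₀ (Z.sup lev + 1) := fun a ha =>
    Finset.mem_Ico.2 ⟨hlev0 a ha, Nat.lt_succ_of_le (Finset.le_sup ha)⟩
  rw [← Finset.sum_fiberwise_of_maps_to hmaps]
  calc _ ≤ ∑ k ∈ Finset.Ico k₀ (Z.sup lev + 1), countConst M B / δ ^ 2 * q ^ k :=
        Finset.sum_le_sum fun k _ => hlevel k
    _ = countConst M B / δ ^ 2 * ∑ k ∈ Finset.Ico k₀ (Z.sup lev + 1), q ^ k := by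
        rw [Finset.mul_sum]
    _ ≤ countConst M B / δ ^ 2 * (q ^ k₀ / (1 - q)) := by
        gcongr
        exact geom_sum_Ico_le_of_lt_one hq0 (by linarith)
    _ = _ := by
        rw [hq]
        congr 1
        field_simp
        simp

/-! ### Boundary behaviour of singular inner functions and Harnack's inequality -/

open MeasureTheory in
lemma ae_circleMap_of_ae_circlePt {p : ℂ → Prop} (h : ∀ᵐ t : ℝ, p (circlePt t)) :
    ∀ᵐ θ : ℝ, p (circleMap 0 1 θ) := by
  have hπ : (2 * Real.pi)⁻¹ ≠ 0 := by positivity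
  have hq : Measure.QuasiMeasurePreserving (fun θ : ℝ => (2 * Real.pi)⁻¹ * θ) volume volume := by
    refine ⟨by fun_prop, ?_⟩
    rw [Real.map_volume_mul_left hπ]
    exact Measure.smul_absolutelyContinuous
  filter_upwards [hq.ae h] with θ hθ
  convert hθ using 1
  unfold circleMap circlePt
  have : (Real.pi : ℂ) ≠ 0 := by exact_mod_cast Real.pi_ne_zero
  push_cast
  simp only [zero_add, one_mul]
  congr 2
  field_simp

lemma mul_mem_disc {r : ℝ} (hr : 0 ≤ r) (hr1 : r < 1) {x : ℂ} (hx : ‖x‖ ≤ 1) :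
    (r : ℂ) * x ∈ disc := by
  rw [mem_disc, norm_mul, Complex.norm_real, Real.norm_of_nonneg hr]
  nlinarith [norm_nonneg x]

lemma poissonKernel_eq_pker {w x : ℂ} (hx : ‖x‖ = 1) : poissonKernel 0 w x = pker w x := by
  simp [poissonKernel, pker, gap, hx]

lemma continuousOn_pker {w : ℂ} (hw : w ∈ disc) : ContinuousOn (pker w) (sphere 0 1) := by
  unfold pker
  refine ContinuousOn.div (by fun_prop) (by fun_prop) fun x hx => ?_
  exact (pow_pos (norm_sub_pos_of_norm_eq_one hw (by simpa using hx)) 2).ne'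

lemma norm_circleMap_one (θ : ℝ) : ‖circleMap 0 1 θ‖ = 1 := by simp

/-- Inner functions are bounded by one. -/
lemma IsInner.norm_le_one {S : ℂ → ℂ} (hS : IsInner S) {z : ℂ} (hz : z ∈ disc) : ‖S z‖ ≤ 1 := by
  obtain ⟨hd, ⟨M, hM⟩, hrad⟩ := hS
  set r : ℕ → ℝ := fun n => 1 - 1 / ((n : ℝ) + 1) with hr
  have hr0 : ∀ n, 0 ≤ r n := fun n => by
    simp only [hr, sub_nonneg]
    rw [div_le_one (by positivity)]
    have : (0 : ℝ) ≤ n := n.cast_nonneg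
    linarith
  have hr1 : ∀ n, r n < 1 := fun n => by
    simp only [hr]
    have : (0 : ℝ) < 1 / ((n : ℝ) + 1) := by positivity
    linarith
  have hrt : Tendsto r atTop (𝓝[<] 1) := by
    refine tendsto_nhdsWithin_iff.2 ⟨?_, Eventually.of_forall hr1⟩
    have := (tendsto_one_div_add_atTop_nhds_zero_nat (𝕜 := ℝ)).const_sub 1
    rwa [sub_zero] at this
  have hrt' : Tendsto r atTop (𝓝 1) := hrt.mono_right nhdsWithin_le_nhds
  have hSc : ContinuousOn S disc := hd.continuousOn
  have hmem : ∀ n θ, (r n : ℂ) * circleMap 0 1 θ ∈ disc := fun n θ =>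
    mul_mem_disc (hr0 n) (hr1 n) (norm_circleMap_one θ).le
  have hcS : ∀ n, Continuous fun θ => S ((r n : ℂ) * circleMap 0 1 θ) := fun n =>
    hSc.comp_continuous (by fun_prop) (hmem n)
  have hcP : Continuous fun θ => pker z (circleMap 0 1 θ) :=
    (continuousOn_pker hz).comp_continuous (by fun_prop) fun θ => by simp
  have hP0 : ∀ θ, 0 ≤ pker z (circleMap 0 1 θ) := fun θ => (pker_pos hz (norm_circleMap_one θ)).le
  -- The Poisson formula for the dilates of S. Dominated convergence with the radial limits then
  -- bounds |S(z)| by the integral of the Poisson kernel, which is 1.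
  have key : ∀ n, ‖S (r n * z)‖
      ≤ (2 * Real.pi)⁻¹ * ∫ θ in 0..2 * Real.pi,
        pker z (circleMap 0 1 θ) * ‖S (r n * circleMap 0 1 θ)‖ := by
    intro n
    have hdc : DiffContOnCl ℂ (fun x => S (r n * x)) (ball 0 1) := by
      refine DifferentiableOn.diffContOnCl ?_
      rw [closure_ball _ one_ne_zero]
      exact hd.comp (by fun_prop) fun x hx => mul_mem_disc (hr0 n) (hr1 n) (by simpa using hx)
    have h1 := hdc.circleAverage_poissonKernel_smul hz
    rw [← h1, Real.circleAverage_def, norm_smul, Real.norm_of_nonneg (by positivity)]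
    gcongr
    refine (intervalIntegral.norm_integral_le_integral_norm (by positivity)).trans (le_of_eq ?_)
    congr 1
    ext θ
    rw [Pi.smul_apply', norm_smul, poissonKernel_eq_pker (norm_circleMap_one θ),
      Real.norm_of_nonneg (hP0 θ)]
  have hlim : Tendsto (fun n => ∫ θ in 0..2 * Real.pi,
      pker z (circleMap 0 1 θ) * ‖S (r n * circleMap 0 1 θ)‖) atTop
      (𝓝 (∫ θ in 0..2 * Real.pi, pker z (circleMap 0 1 θ))) := by
    refine intervalIntegral.tendsto_integral_filter_of_dominated_convergence
      (fun θ => pker z (circleMap 0 1 θ) * M) (Eventually.of_forall fun n => ?_)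
      (Eventually.of_forall fun n => Eventually.of_forall fun θ _ => ?_) ?_ ?_
    · exact (hcP.mul (hcS n).norm).aestronglyMeasurable
    · rw [norm_mul, norm_norm, Real.norm_of_nonneg (hP0 θ)]
      exact mul_le_mul_of_nonneg_left (hM _ (hmem n θ)) (hP0 θ)
    · exact (hcP.mul continuous_const).intervalIntegrable _ _
    · filter_upwards [ae_circleMap_of_ae_circlePt
        (p := fun x => ∃ l : ℂ, ‖l‖ = 1 ∧ Tendsto (fun r : ℝ => S ((r : ℂ) * x)) (𝓝[<] 1) (𝓝 l))
        hrad] with θ hθ _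
      obtain ⟨l, hl, hθ⟩ := hθ
      have := ((hθ.comp hrt).norm).const_mul (pker z (circleMap 0 1 θ))
      rwa [hl, mul_one] at this
  have hone : (2 * Real.pi)⁻¹ * ∫ θ in 0..2 * Real.pi, pker z (circleMap 0 1 θ) = 1 := by
    have hdc : DiffContOnCl ℂ (fun _ : ℂ => (1 : ℂ)) (ball 0 1) := diffContOnCl_const
    have h1 := hdc.circleAverage_poissonKernel_smul hz
    rw [Real.circleAverage_def] at h1
    have h2 : ∫ θ in 0..2 * Real.pi, (poissonKernel 0 z • fun _ : ℂ => (1 : ℂ)) (circleMap 0 1 θ)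
        = ((∫ θ in 0..2 * Real.pi, pker z (circleMap 0 1 θ) : ℝ) : ℂ) := by
      rw [← intervalIntegral.integral_ofReal]
      congr 1
      ext θ
      rw [Pi.smul_apply', poissonKernel_eq_pker (norm_circleMap_one θ)]
      simp
    rw [h2, Complex.real_smul] at h1
    exact_mod_cast h1
  have hSlim : Tendsto (fun n => ‖S (r n * z)‖) atTop (𝓝 ‖S z‖) := by
    have h1 : ContinuousAt S z := hSc.continuousAt (isOpen_ball.mem_nhds hz)
    have h2 : Tendsto (fun n => (r n : ℂ) * z) atTop (𝓝 z) := by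
      have : Tendsto (fun n => (r n : ℂ)) atTop (𝓝 ((1 : ℝ) : ℂ)) :=
        (Complex.continuous_ofReal.tendsto 1).comp hrt'
      simpa using this.mul_const z
    exact (h1.tendsto.comp h2).norm
  have h3 := le_of_tendsto_of_tendsto' hSlim (hlim.const_mul _) key
  rwa [hone] at h3

/-- At a regular boundary point, the modulus of an inner function tends to one. -/
lemma IsInner.tendsto_norm {S : ℂ → ℂ} (hS : IsInner S) {ζ : ℂ} (hζ : ζ ∈ unitCircle)
    (hreg : ζ ∉ sing S) : Tendsto (fun z => ‖S z‖) (𝓝[disc] ζ) (𝓝 1) := by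
  obtain ⟨g, hg, hgS⟩ : ∃ g : ℂ → ℂ, AnalyticAt ℂ g ζ ∧ ∀ᶠ z in 𝓝[disc] ζ, g z = S z := by
    by_contra h
    exact hreg ⟨hζ, h⟩
  suffices h : ‖g ζ‖ = 1 by
    rw [← h]
    refine Tendsto.congr' ?_ (hg.continuousAt.norm.tendsto.mono_left nhdsWithin_le_nhds)
    filter_upwards [hgS] with z hz
    rw [hz]
  obtain ⟨t₀, _, rfl⟩ := exists_circlePt_eq (mem_unitCircle.1 hζ) 0
  by_contra hne
  have hev : ∀ᶠ x in 𝓝 (circlePt t₀), ‖g x‖ ≠ 1 ∧ ContinuousAt g x ∧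
      ∀ᶠ z in 𝓝[disc] x, g z = S z := by
    refine (hg.continuousAt.norm.eventually_ne hne).and ((hg.eventually_analyticAt.mono
      fun x hx => hx.continuousAt).and ?_)
    rw [eventually_nhdsWithin_iff] at hgS
    filter_upwards [eventually_eventually_nhds.2 hgS] with x hx
    exact eventually_nhdsWithin_iff.2 hx
  have hevt := (continuous_circlePt.tendsto t₀).eventually hev
  -- A set of full measure is dense, so some point with a unimodular radial limit lies where |g| ≠
  -- 1; there the radial limit must equal g.
  obtain ⟨t, ⟨l, hl, ht⟩, h1, h2, h3⟩ :=
    (MeasureTheory.Measure.dense_of_ae hS.2.2).inter_nhds_nonempty hevt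
  have hto : Tendsto (fun r : ℝ => (r : ℂ) * circlePt t) (𝓝[<] 1) (𝓝[disc] (circlePt t)) := by
    refine tendsto_nhdsWithin_iff.2 ⟨?_, ?_⟩
    · have : Tendsto (fun r : ℝ => (r : ℂ) * circlePt t) (𝓝 1) (𝓝 (((1 : ℝ) : ℂ) * circlePt t)) :=
        ((Complex.continuous_ofReal.tendsto 1).mul_const _)
      rw [Complex.ofReal_one, one_mul] at this
      exact this.mono_left nhdsWithin_le_nhds
    · filter_upwards [Ioo_mem_nhdsLT (zero_lt_one (α := ℝ))] with r hr
      exact mul_mem_disc hr.1.le hr.2 (norm_circlePt t).le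
  have h4 : Tendsto (fun r : ℝ => S ((r : ℂ) * circlePt t)) (𝓝[<] 1) (𝓝 (g (circlePt t))) := by
    refine Tendsto.congr' (hto.eventually h3) ?_
    exact h2.tendsto.comp (hto.mono_right nhdsWithin_le_nhds)
  exact h1 (by rw [tendsto_nhds_unique h4 ht, hl])

lemma IsSingularInner.ne_zero {S : ℂ → ℂ} (hS : IsSingularInner S) {z : ℂ} (hz : z ∈ disc) :
    S z ≠ 0 := fun h => by
  have : z ∈ zeroSet S := ⟨hz, h⟩
  rw [hS.2] at this
  exact this

lemma IsSingularInner.log_nonpos {S : ℂ → ℂ} (hS : IsSingularInner S) {z : ℂ} (hz : z ∈ disc) :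
    Real.log ‖S z‖ ≤ 0 := Real.log_nonpos (norm_nonneg _) (hS.1.norm_le_one hz)

lemma IsSingularInner.continuousAt_log {S : ℂ → ℂ} (hS : IsSingularInner S) {z : ℂ}
    (hz : z ∈ disc) : ContinuousAt (fun z => Real.log ‖S z‖) z :=
  (hS.1.1.continuousOn.continuousAt (isOpen_ball.mem_nhds hz)).norm.log
    (norm_ne_zero_iff.2 (hS.ne_zero hz))

lemma tendsto_ofReal_mul_nhdsLT_one (z : ℂ) :
    Tendsto (fun r : ℝ => (r : ℂ) * z) (𝓝[<] 1) (𝓝 z) := by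
  have : Tendsto (fun r : ℝ => (r : ℂ) * z) (𝓝 1) (𝓝 (((1 : ℝ) : ℂ) * z)) :=
    ((Complex.continuous_ofReal.tendsto 1).mul_const _)
  rw [Complex.ofReal_one, one_mul] at this
  exact this.mono_left nhdsWithin_le_nhds

/-- Harnack's inequality for the logarithm of a singular inner function, with the constant
determined by the singular set. -/
lemma IsSingularInner.log_le {S : ℂ → ℂ} (hS : IsSingularInner S) {E : Set ℂ}
    (hSE : sing S ⊆ E) {l : ℝ} (hl : 0 ≤ l) {z w : ℂ} (hz : z ∈ disc) (hw : w ∈ disc)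
    (h : ∀ x ∈ E, ‖x‖ = 1 → pker w x ≤ l * pker z x) :
    -Real.log ‖S w‖ ≤ l * -Real.log ‖S z‖ := by
  set u : ℂ → ℝ := fun z => -Real.log ‖S z‖ with hu
  change u w ≤ l * u z
  have hu0 : ∀ z ∈ disc, 0 ≤ u z := fun z hz => neg_nonneg.2 (hS.log_nonpos hz)
  have huc : ∀ z ∈ disc, ContinuousAt u z := fun z hz => (hS.continuousAt_log hz).neg
  -- The slack l' > l makes the compact set K, on which the kernel inequality fails or is an
  -- equality, disjoint from the singular set. No representing measure is needed: u(rx) tends to 0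
  -- uniformly on K.
  have step : ∀ l' > l, u w ≤ l' * u z := by
    intro l' hl'
    set K : Set ℂ := {x | x ∈ sphere (0 : ℂ) 1 ∧ l' * pker z x ≤ pker w x} with hK
    have hKc : IsCompact K := by
      refine (isCompact_sphere (0 : ℂ) 1).of_isClosed_subset ?_ fun x hx => hx.1
      exact isClosed_sphere.isClosed_le (continuousOn_const.mul (continuousOn_pker hz))
        (continuousOn_pker hw)
    have hKE : ∀ x ∈ K, x ∉ sing S := by
      rintro x ⟨hx, hle⟩ hxs
      have hx1 : ‖x‖ = 1 := by simpa using hx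
      have h1 := h x (hSE hxs) hx1
      have h2 := pker_pos hz hx1
      nlinarith
    set C := (1 + ‖w‖) / (1 - ‖w‖) with hC
    have hC0 : 0 < C := by
      have := mem_disc.1 hw
      have := norm_nonneg w
      exact div_pos (by linarith) (by linarith)
    have hunif : ∀ ε > 0, ∀ᶠ r : ℝ in 𝓝 1, ∀ x ∈ K, (r : ℂ) * x ∈ disc → u (r * x) ≤ ε := by
      intro ε hε
      refine hKc.eventually_forall_of_forall_eventually
        (P := fun (r : ℝ) (x : ℂ) => (r : ℂ) * x ∈ disc → u (r * x) ≤ ε) fun x hx => ?_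
      have h1 := hS.1.tendsto_norm hx.1 (hKE x hx)
      have h2 : Tendsto u (𝓝[disc] x) (𝓝 0) := by
        have := (h1.log one_ne_zero).neg
        simpa using this
      have h3 : ∀ᶠ y in 𝓝[disc] x, u y < ε := h2.eventually_lt_const hε
      rw [eventually_nhdsWithin_iff] at h3
      have h4 : Tendsto (fun p : ℝ × ℂ => (p.1 : ℂ) * p.2) (𝓝 ((1 : ℝ), x)) (𝓝 x) := by
        have : Continuous fun p : ℝ × ℂ => (p.1 : ℂ) * p.2 := by fun_prop
        simpa using this.tendsto ((1 : ℝ), x)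
      filter_upwards [h4.eventually h3] with p hp hpd
      exact (hp hpd).le
    have key : ∀ ε > 0, u w ≤ l' * u z + C * ε := by
      intro ε hε
      have hev : ∀ᶠ r : ℝ in 𝓝[<] 1, u (r * w) ≤ l' * u (r * z) + C * ε := by
        filter_upwards [nhdsWithin_le_nhds (hunif ε hε), Ioo_mem_nhdsLT (zero_lt_one (α := ℝ))]
          with r hr hr01
        have hrd : ∀ x : ℂ, ‖x‖ ≤ 1 → (r : ℂ) * x ∈ disc := fun x hx =>
          mul_mem_disc hr01.1.le hr01.2 hx
        have hharm : InnerProductSpace.HarmonicOnNhd (fun x : ℂ => Real.log ‖S (r * x)‖)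
            (closedBall 0 1) := by
          intro x hx
          have hx' : ‖x‖ ≤ 1 := by simpa using hx
          have ha : AnalyticAt ℂ S (r * x) := hS.1.1.analyticAt (isOpen_ball.mem_nhds (hrd x hx'))
          have ha' : AnalyticAt ℂ (fun x : ℂ => S (r * x)) x :=
            ha.fun_comp (analyticAt_const.mul analyticAt_id)
          exact ha'.harmonicAt_log_norm (hS.ne_zero (hrd x hx'))
        have hpw := hharm.circleAverage_poissonKernel_smul hw
        have hpz := hharm.circleAverage_poissonKernel_smul hz
        have hcont : ContinuousOn (fun x : ℂ => Real.log ‖S (r * x)‖) (sphere 0 1) := by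
          intro x hx
          have hx' : ‖x‖ ≤ 1 := by simpa using (mem_sphere_zero_iff_norm.1 hx).le
          exact ((hS.continuousAt_log (hrd x hx')).comp'
            (by fun_prop : ContinuousAt (fun x : ℂ => (r : ℂ) * x) x)).continuousWithinAt
        have hci : ∀ v ∈ disc, CircleIntegrable
            (poissonKernel 0 v • fun x : ℂ => Real.log ‖S (r * x)‖) 0 1 := by
          intro v hv
          refine ContinuousOn.circleIntegrable zero_le_one ?_
          refine ContinuousOn.smul ?_ hcont
          exact (continuousOn_pker hv).congr fun x hx =>
            poissonKernel_eq_pker (mem_sphere_zero_iff_norm.1 hx)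
        have hmain := Real.circleAverage_mono_on_of_le_circle (a := C * ε)
          (((hci z hz).const_smul (a := l')).sub (hci w hw)) (by
            intro x hx
            have hx1 : ‖x‖ = 1 := by simpa using hx
            have e : ∀ v, (poissonKernel 0 v • fun x : ℂ => Real.log ‖S (r * x)‖) x
                = pker v x * Real.log ‖S (r * x)‖ := fun v => by
              rw [Pi.smul_apply', poissonKernel_eq_pker hx1, smul_eq_mul]
            rw [Pi.sub_apply, Pi.smul_apply, e, e, smul_eq_mul]
            have hPw := pker_pos hw hx1
            have hPz := pker_pos hz hx1
            have hPC : pker w x ≤ C := pker_le hw hx1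
            have hux := hu0 _ (hrd x hx1.le)
            simp only [hu] at hux
            -- On K the integrand is controlled by the smallness of u(rx); off K by the kernel
            -- inequality and the sign of u.
            by_cases hxK : x ∈ K
            · have h1 := hr x hxK (hrd x hx1.le)
              simp only [hu] at h1
              have h2 : pker w x * -Real.log ‖S (r * x)‖ ≤ C * ε :=
                mul_le_mul hPC h1 hux hC0.le
              have h3 : 0 ≤ l' * (pker z x * -Real.log ‖S (r * x)‖) :=
                mul_nonneg (hl.trans hl'.le) (mul_nonneg hPz.le hux)
              linarith
            · have h1 : pker w x < l' * pker z x := by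
                by_contra! hcon
                exact hxK ⟨by simpa using hx1, hcon⟩
              have : 0 < C * ε := by positivity
              nlinarith)
        rw [Real.circleAverage_sub ((hci z hz).const_smul) (hci w hw), Real.circleAverage_smul,
          hpw, hpz, smul_eq_mul] at hmain
        simp only [hu]
        linarith
      refine le_of_tendsto_of_tendsto ?_ ?_ hev
      · exact (huc w hw).tendsto.comp (tendsto_ofReal_mul_nhdsLT_one w)
      · exact (((huc z hz).tendsto.comp (tendsto_ofReal_mul_nhdsLT_one z)).const_mul _).add_const _
    refine le_of_forall_pos_le_add fun ε hε => ?_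
    have := key (ε / C) (by positivity)
    rwa [mul_div_cancel₀ _ hC0.ne'] at this
  refine le_of_forall_pos_le_add fun ε hε => ?_
  have h1 : 0 ≤ u z := hu0 z hz
  have h2 := step (l + ε / (u z + 1)) (by
    have : 0 < ε / (u z + 1) := by positivity
    linarith)
  have h3 : ε / (u z + 1) * u z ≤ ε := by
    rw [div_mul_eq_mul_div, div_le_iff₀ (by positivity)]
    nlinarith
  linarith

/-! ### Porous sets: construction of the Blaschke product -/

/-- Zorn's lemma: if maximality failed to give a close point of Z, then z could be added to Z. -/
lemma exists_maximal_separated {δ : ℝ} (hδ : 0 < δ) {U : Set ℂ} (hU : U ⊆ disc) :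
    ∃ Z ⊆ U, (∀ a ∈ Z, ∀ b ∈ Z, a ≠ b → δ ^ 2 * (gap a * gap b) ≤ ‖a - b‖ ^ 2) ∧
      ∀ z ∈ U, ∃ a ∈ Z, ‖z - a‖ ^ 2 < δ ^ 2 * (gap z * gap a) := by
  obtain ⟨Z, hZ⟩ := zorn_subset
    {Z : Set ℂ | Z ⊆ U ∧ ∀ a ∈ Z, ∀ b ∈ Z, a ≠ b → δ ^ 2 * (gap a * gap b) ≤ ‖a - b‖ ^ 2} (by
      intro c hc hchain
      refine ⟨⋃₀ c, ⟨Set.sUnion_subset fun s hs => (hc hs).1, ?_⟩,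
        fun s hs => Set.subset_sUnion_of_mem hs⟩
      rintro a ⟨s, hs, has⟩ b ⟨t, ht, hbt⟩ hab
      rcases hchain.total hs ht with hst | hts
      · exact (hc ht).2 a (hst has) b hbt hab
      · exact (hc hs).2 a has b (hts hbt) hab)
  refine ⟨Z, hZ.prop.1, hZ.prop.2, fun z hz => ?_⟩
  by_contra! hcon
  have hzZ : z ∈ Z := by
    have h1 : insert z Z ⊆ Z := hZ.le_of_ge ⟨Set.insert_subset hz hZ.prop.1, ?_⟩
      (Set.subset_insert z Z)
    · exact h1 (Set.mem_insert z Z)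
    · rintro a (rfl | ha) b (rfl | hb) hab
      · exact absurd rfl hab
      · exact hcon b hb
      · rw [norm_sub_rev, mul_comm (gap a)]
        exact hcon a ha
      · exact hZ.prop.2 a ha b hb hab
  have h1 := hcon z hzZ
  have h2 := gap_pos (hU hz)
  rw [sub_self, norm_zero] at h1
  have : 0 < δ ^ 2 * (gap z * gap z) := by positivity
  linarith

lemma gap_mob_comm (z a : ℂ) : gap (mob z a) = gap (mob a z) := by
  rw [← one_sub_rho_sq, ← one_sub_rho_sq, rho_comm]

lemma mob_injOn {z : ℂ} (hz : z ∈ disc) : Set.InjOn (mob z) disc := by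
  intro a ha b hb hab
  have h := norm_mob_sub_mob hz (mem_disc.1 ha).le (mem_disc.1 hb).le
  rw [hab, sub_self, norm_zero] at h
  have h1 := norm_pos_iff.2 (one_sub_conj_mul_ne_zero hz (mem_disc.1 ha).le)
  have h2 := norm_pos_iff.2 (one_sub_conj_mul_ne_zero hz (mem_disc.1 hb).le)
  have h3 := gap_pos hz
  have h4 := (div_eq_zero_iff.1 h.symm).resolve_right (by positivity)
  have h5 := (mul_eq_zero.1 h4).resolve_right h3.ne'
  exact sub_eq_zero.1 (norm_eq_zero.1 h5)

lemma separated_mob {z a b : ℂ} {δ : ℝ} (hz : z ∈ disc) (ha : a ∈ disc) (hb : b ∈ disc)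
    (h : δ ^ 2 * (gap a * gap b) ≤ ‖a - b‖ ^ 2) :
    δ ^ 2 * (gap (mob z a) * gap (mob z b)) ≤ ‖mob z a - mob z b‖ ^ 2 := by
  have ha1 := (mem_disc.1 ha).le
  have hb1 := (mem_disc.1 hb).le
  have h1 := norm_pos_iff.2 (one_sub_conj_mul_ne_zero hz ha1)
  have h2 := norm_pos_iff.2 (one_sub_conj_mul_ne_zero hz hb1)
  rw [norm_mob_sub_mob hz ha1 hb1, gap_mob hz ha1, gap_mob hz hb1]
  generalize ‖1 - conj z * a‖ = p at *
  generalize ‖1 - conj z * b‖ = r at *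
  calc _ = δ ^ 2 * (gap a * gap b) * (gap z ^ 2 / (p * r) ^ 2) := by field_simp
    _ ≤ ‖a - b‖ ^ 2 * (gap z ^ 2 / (p * r) ^ 2) := by gcongr
    _ = _ := by field_simp

/-- The sum over separated points at which a singular inner function is very small, as seen from a
point at which it is not small. -/
lemma IsSingularInner.sum_gap_mob_le {S : ℂ → ℂ} (hS : IsSingularInner S) {E : Set ℂ}
    (hE : E ⊆ unitCircle) (hSE : sing S ⊆ E) {c : ℝ} (hc : 0 < c) (hc1 : c ≤ 1)
    (h : MobPorous c E) {M : ℕ} (hM : 512 / c ^ 2 ≤ M) {p : ℕ}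
    (hp : (1 - 1 / (M : ℝ)) ^ p ≤ 1 / 8) {K : ℝ} (hK : 0 < K) {e : ℕ}
    (he : 4 * K ≤ ((M : ℝ) ^ 2) ^ e) {z : ℂ} (hz : z ∈ disc) (hzK : -Real.log ‖S z‖ ≤ K) (j : ℕ)
    (s : Finset ℂ) (hs : ∀ a ∈ s, a ∈ disc ∧ ((M : ℝ) ^ 2) ^ (p * j) < -Real.log ‖S a‖)
    (hsep : ∀ a ∈ s, ∀ b ∈ s, a ≠ b → ((1 / 2 : ℝ) ^ j) ^ 2 * (gap a * gap b) ≤ ‖a - b‖ ^ 2) :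
    ∑ a ∈ s, gap (mob z a)
      ≤ countConst M (√K) * M / (1 - 1 / (M : ℝ)) ^ e * (1 / 2) ^ j := by
  classical
  have hM2' : (2 : ℝ) ≤ M := by
    refine le_trans ?_ hM
    rw [le_div_iff₀ (by positivity)]
    nlinarith
  have hM0 : (0 : ℝ) < M := by linarith
  have hy1 : 1 / (M : ℝ) < 1 := by rw [div_lt_one hM0]; linarith
  have hM1 : (1 : ℝ) ≤ M ^ 2 := one_le_pow₀ (by linarith)
  have hinj : Set.InjOn (mob z) s := (mob_injOn hz).mono fun a ha => (hs a ha).1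
  set q := 1 - 1 / (M : ℝ) with hq
  have hq0 : 0 < q := by linarith
  have hq1 : q ≤ 1 := by
    have : 0 < 1 / (M : ℝ) := by positivity
    linarith
  -- Harnack gives M^(2pj) < 4K / gap, and 4K ≤ M^(2e). The subtraction is truncated; when pj < e
  -- the claim is just gap ≤ 1.
  have hgap : ∀ a ∈ s, gap (mob z a) ≤ ((1 / (M : ℝ)) ^ 2) ^ (p * j - e) := by
    intro a ha
    obtain ⟨had, hau⟩ := hs a ha
    have hga := gap_pos (mob_mem_disc hz had)
    rcases le_or_gt e (p * j) with hle | hgt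
    · have h1 := hS.log_le hSE (l := 4 / gap (mob z a)) (by positivity) hz had fun x _ hx1 => by
        rw [pker_mob hz had hx1]
        exact mul_le_mul_of_nonneg_right
          (pker_le_four_div (mob_mem_disc hz had) (norm_mob_eq_one hz hx1)) (pker_pos hz hx1).le
      have h2 : ((M : ℝ) ^ 2) ^ (p * j) < 4 / gap (mob z a) * K :=
        hau.trans_le (h1.trans (by gcongr))
      rw [div_mul_eq_mul_div, lt_div_iff₀ hga] at h2
      obtain ⟨k, hk⟩ := Nat.exists_eq_add_of_le hle
      rw [hk, pow_add, mul_assoc] at h2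
      rw [hk, Nat.add_sub_cancel_left, one_div_pow, one_div_pow, le_div_iff₀ (by positivity),
        mul_comm]
      have h3 : ((M : ℝ) ^ 2) ^ e * (((M : ℝ) ^ 2) ^ k * gap (mob z a))
          < ((M : ℝ) ^ 2) ^ e * 1 := by linarith
      exact (lt_of_mul_lt_mul_left h3 (by positivity)).le
    · rw [Nat.sub_eq_zero_of_le hgt.le, pow_zero]
      exact gap_le_one _
  -- Otherwise the kernel at the moved point is below 1/K on the whole moved set, and Harnack gives
  -- u(a) ≤ u(z)/K ≤ 1, too small for a point of this family.
  have hnear : ∀ a ∈ s, ∃ x ∈ mob z '' E, ‖x - mob z a‖ ^ 2 ≤ √K ^ 2 * gap (mob z a) := by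
    intro a ha
    obtain ⟨had, hau⟩ := hs a ha
    by_contra! hcon
    have h1 := hS.log_le hSE (l := 1 / K) (by positivity) hz had fun x hxE hx1 => by
      rw [pker_mob hz had hx1]
      refine mul_le_mul_of_nonneg_right ?_ (pker_pos hz hx1).le
      have h2 := hcon _ ⟨x, hxE, rfl⟩
      rw [Real.sq_sqrt hK.le] at h2
      have h3 := norm_sub_pos_of_norm_eq_one (mob_mem_disc hz had) (norm_mob_eq_one hz hx1)
      rw [pker, div_le_div_iff₀ (by positivity) hK]
      linarith
    have h2 : 1 / K * -Real.log ‖S z‖ ≤ 1 := by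
      rw [one_div, inv_mul_le_iff₀ hK]; linarith
    have h3 : (1 : ℝ) ≤ ((M : ℝ) ^ 2) ^ (p * j) := one_le_pow₀ hM1
    linarith
  have hmain := sum_gap_le hc hc1 (F := mob z '' E)
    (by rintro _ ⟨x, hx, rfl⟩; exact mem_unitCircle.2 (norm_mob_eq_one hz (mem_unitCircle.1 (hE hx))))
    (h.image hE hz) hM (B := √K) (δ := (1 / 2) ^ j) (Real.sqrt_nonneg K) (by positivity)
    (pow_le_one₀ (by norm_num) (by norm_num)) (s.image (mob z))
    (by simpa using fun a ha => mob_mem_disc hz (hs a ha).1)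
    (by simpa using hnear)
    (by
      intro a' ha' b' hb' hab
      obtain ⟨a, ha, rfl⟩ := Finset.mem_image.1 ha'
      obtain ⟨b, hb, rfl⟩ := Finset.mem_image.1 hb'
      exact separated_mob hz (hs a ha).1 (hs b hb).1
        (hsep a ha b hb (by rintro rfl; exact hab rfl)))
    (p * j - e) (by simpa using hgap)
  rw [Finset.sum_image hinj] at hmain
  refine hmain.trans ?_
  -- Since q^p ≤ 1/8, this yields 8^(-j) up to a constant, which against the separation loss 4^j
  -- leaves 2^(-j).
  have hqe : q ^ (p * j - e) ≤ (1 / 8) ^ j / q ^ e := by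
    rw [le_div_iff₀ (by positivity), ← pow_add]
    calc q ^ (p * j - e + e) ≤ q ^ (p * j) := pow_le_pow_of_le_one hq0.le hq1 (by omega)
      _ = (q ^ p) ^ j := pow_mul _ _ _
      _ ≤ _ := by gcongr
  have hcc := (countConst_pos M (Real.sqrt_nonneg K)).le
  calc countConst M (√K) / ((1 / 2) ^ j) ^ 2 * (q ^ (p * j - e) * M)
      ≤ countConst M (√K) / ((1 / 2) ^ j) ^ 2 * ((1 / 8) ^ j / q ^ e * M) := by gcongr
    _ = countConst M (√K) * M / q ^ e * ((1 / 8) ^ j / ((1 / 2) ^ j) ^ 2) := by field_simp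
    _ = _ := by
      congr 1
      rw [← pow_mul, mul_comm j 2, pow_mul, ← div_pow]
      norm_num

/-- Sums over the fibres decay like 2^(-j), and these powers add up to 2. -/
lemma sum_sigma_le {Z : ℕ → Set ℂ} {f : ℂ → ℝ} {C : ℝ}
    (h : ∀ j, ∀ s : Finset ℂ, (∀ a ∈ s, a ∈ Z j) → ∑ a ∈ s, f a ≤ C * (1 / 2) ^ j)
    (t : Finset (Σ j, Z j)) : ∑ i ∈ t, f i.2 ≤ 2 * C := by
  classical
  have hC : 0 ≤ C := by simpa using h 0 ∅ (by simp)
  have hmaps : ∀ i ∈ t, i.1 ∈ t.image Sigma.fst := fun i hi => Finset.mem_image_of_mem _ hi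
  rw [← Finset.sum_fiberwise_of_maps_to hmaps]
  have h1 : ∀ j ∈ t.image Sigma.fst, ∑ i ∈ t with i.1 = j, f i.2 ≤ C * (1 / 2) ^ j := by
    intro j _
    have h2 := h j ((t.filter (·.1 = j)).image fun i => (i.2 : ℂ)) (by
      intro a ha
      obtain ⟨i, hi, rfl⟩ := Finset.mem_image.1 ha
      obtain ⟨_, rfl⟩ := Finset.mem_filter.1 hi
      exact i.2.2)
    rwa [Finset.sum_image] at h2
    rintro ⟨j₁, a⟩ hi ⟨j₂, b⟩ hi' hab
    obtain ⟨_, rfl⟩ := Finset.mem_filter.1 hi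
    obtain ⟨_, h3⟩ := Finset.mem_filter.1 hi'
    obtain rfl : j₂ = j₁ := h3
    simp only at hab
    rw [Subtype.ext hab]
  refine (Finset.sum_le_sum h1).trans ?_
  rw [← Finset.mul_sum, mul_comm 2 C]
  gcongr
  exact (summable_geometric_two.sum_le_tsum _ fun j _ => by positivity).trans
    tsum_geometric_two.le

/-- A singular inner function whose singular set lies in a porous set is easily wepable. -/
theorem IsSingularInner.isEasilyWepable {S : ℂ → ℂ} (hS : IsSingularInner S) {E : Set ℂ}
    (hE : E ⊆ unitCircle) (hSE : sing S ⊆ E) (hpor : IsPorous E) : IsEasilyWepable S := by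
  obtain ⟨c, hc, hc1, h⟩ := hpor.exists_mobPorous hE
  obtain ⟨M, hM⟩ := exists_nat_ge (512 / c ^ 2)
  have hM2' : (2 : ℝ) ≤ M := by
    refine le_trans ?_ hM
    rw [le_div_iff₀ (by positivity)]
    nlinarith
  have hM0 : (0 : ℝ) < M := by linarith
  have hM1 : (1 : ℝ) < M ^ 2 := one_lt_pow₀ (by linarith) two_ne_zero
  have hy0 : 0 < 1 / (M : ℝ) := by positivity
  have hy1 : 1 / (M : ℝ) < 1 := by rw [div_lt_one hM0]; linarith
  obtain ⟨p, hp⟩ := exists_pow_lt_of_lt_one (show (0 : ℝ) < 1 / 8 by norm_num)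
    (show 1 - 1 / (M : ℝ) < 1 by linarith)
  set U : ℕ → Set ℂ := fun j => {a | a ∈ disc ∧ ((M : ℝ) ^ 2) ^ (p * j) < -Real.log ‖S a‖} with hU
  choose Z hZU hZsep hZmax using fun j => exists_maximal_separated
    (show (0 : ℝ) < (1 / 2) ^ j by positivity) (show U j ⊆ disc from fun a ha => ha.1)
  have hsum : ∀ K > 0, ∃ C, ∀ z ∈ disc, -Real.log ‖S z‖ ≤ K → ∀ t : Finset (Σ j, Z j),
      ∑ i ∈ t, gap (mob z i.2) ≤ C := by
    intro K hK
    obtain ⟨e, he⟩ := pow_unbounded_of_one_lt (4 * K) hM1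
    refine ⟨2 * (countConst M (√K) * M / (1 - 1 / (M : ℝ)) ^ e), fun z hz hzK t => ?_⟩
    refine sum_sigma_le (f := fun a => gap (mob z a)) (fun j s hs => ?_) t
    exact hS.sum_gap_mob_le hE hSE hc hc1 h hM hp.le hK he.le hz hzK j s
      (fun a ha => hZU j (hs a ha)) fun a ha b hb => hZsep j a (hs a ha) b (hs b hb)
  -- A point lying in several of the Z_j is a zero with the corresponding multiplicity.
  set f : (Σ j, Z j) → ℂ := fun i => i.2 with hf
  have hfd : ∀ i, f i ∈ disc := fun i => (hZU i.1 i.2.2).1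
  have hfs : Summable fun i => 1 - ‖f i‖ := by
    have h0 : (0 : ℂ) ∈ disc := by simp
    have hu0 : 0 ≤ -Real.log ‖S 0‖ := neg_nonneg.2 (hS.log_nonpos h0)
    obtain ⟨C, hC⟩ := hsum (-Real.log ‖S 0‖ + 1) (by linarith)
    refine summable_of_sum_le (c := C) (fun i => sub_nonneg.2 (mem_disc.1 (hfd i)).le) fun t => ?_
    refine (Finset.sum_le_sum fun i _ => ?_).trans (hC 0 h0 (by linarith) t)
    have : mob 0 (i.2 : ℂ) = i.2 := by simp [mob]
    rw [this]
    exact one_sub_norm_le_gap (mem_disc.1 (hfd i)).le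
  set B : ℂ → ℂ := fun z => ∏' i, blaschkeFactor (f i) z with hB
  have hBp : ∀ z ∈ disc, HasProd (fun i => blaschkeFactor (f i) z) (B z) := fun z hz =>
    (multipliable_blaschkeFactor hfd hfs hz).hasProd
  have hB0 : ∀ i, B (f i) = 0 := fun i =>
    (hBp _ (hfd i)).unique (hasProd_zero_of_exists_eq_zero ⟨i, blaschkeFactor_self _⟩)
  refine ⟨Real.exp (-1), by rw [Real.exp_lt_one_iff]; norm_num, B, ⟨_, f, hfd, hfs, hBp⟩, ?_, ?_⟩
  · intro ε hε
    obtain ⟨j, hj⟩ := exists_pow_lt_of_lt_one hε (show (1 / 2 : ℝ) < 1 by norm_num)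
    set K := ((M : ℝ) ^ 2) ^ (p * j) with hK
    have hK0 : 0 < K := by positivity
    obtain ⟨C, hC⟩ := hsum K hK0
    have hpos : 0 < Real.exp (-K) * Real.exp (-(C / (2 * ε ^ 2))) := by positivity
    refine lt_of_lt_of_le (ENNReal.ofReal_pos.2 hpos) (le_iInf₂ fun z hz => ?_)
    obtain ⟨hzd, hzr⟩ := hz
    refine ENNReal.ofReal_le_ofReal ?_
    have hrho : ∀ i, ε < rho z (f i) := by
      intro i
      have h1 : f i ∈ zeroSet fun z => S z * B z := ⟨hfd i, by simp only [hB0, mul_zero]⟩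
      have h2 := hzr.trans_le (iInf₂_le (f i) h1)
      exact (ENNReal.ofReal_lt_ofReal_iff_of_nonneg hε.le).1 h2
    -- Otherwise z lies in U_j, and maximality of Z_j puts a zero within ρ-distance 2^(-j) < ε.
    have huK : -Real.log ‖S z‖ ≤ K := by
      by_contra! hlt
      obtain ⟨a, ha, hza⟩ := hZmax j z ⟨hzd, hlt⟩
      have h1 := rho_lt_of_norm_sub_sq_lt hzd (hZU j ha).1 (by positivity) hza
      have h2 := hrho ⟨j, a, ha⟩
      simp only [hf] at h2
      linarith
    rw [norm_mul]
    refine mul_le_mul ?_ ?_ (Real.exp_pos _).le (norm_nonneg _)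
    · rw [← Real.le_log_iff_exp_le (norm_pos_iff.2 (hS.ne_zero hzd))]
      linarith
    · refine exp_le_norm_of_hasProd hfd hzd hε (hBp z hzd) (fun i => (hrho i).le) fun t => ?_
      refine le_trans (Finset.sum_le_sum fun i _ => ?_) (hC z hzd huK t)
      rw [one_sub_rho_sq, gap_mob_comm]
  -- Every zero lies in some U_j, and the threshold there is at least 1; hence m = e^(-1).
  · rintro z ⟨hzd, hz0⟩
    obtain ⟨i, rfl⟩ := exists_eq_of_hasProd_zero hfd hfs hzd (hz0 ▸ hBp z hzd)
    refine ⟨hzd, ?_⟩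
    have h1 := (hZU i.1 i.2.2).2
    have h2 : (1 : ℝ) ≤ ((M : ℝ) ^ 2) ^ (p * i.1) := one_le_pow₀ hM1.le
    rw [← Real.log_lt_iff_lt_exp (norm_pos_iff.2 (hS.ne_zero hzd))]
    simp only [hf]
    linarith

/-! ### Sets which are not porous -/

/-- Every interval of length `d` in `[a, a + l]` contains a parameter of a point of `E`. -/
def DenseOn (E : Set ℂ) (a l d : ℝ) : Prop :=
  ∀ s, a ≤ s → s + d ≤ a + l → ∃ t ∈ Set.Icc s (s + d), circlePt t ∈ E

lemma DenseOn.mono {E : Set ℂ} {a l d a' l' d' : ℝ} (h : DenseOn E a l d) (ha : a ≤ a')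
    (hl : a' + l' ≤ a + l) (hd : d ≤ d') : DenseOn E a' l' d' := fun s hs hs' => by
  obtain ⟨t, ht, htE⟩ := h s (by linarith) (by linarith)
  exact ⟨t, ⟨ht.1, by linarith [ht.2]⟩, htE⟩

lemma exists_denseOn_of_not_isPorous {E : Set ℂ} (h : ¬ IsPorous E) {n : ℕ} (hn : 1 ≤ n) :
    ∃ a l : ℝ, 0 ≤ a ∧ a ≤ 1 ∧ 0 < l ∧ l ≤ 1 ∧ DenseOn E a l (l / n) := by
  have hn0 : (0 : ℝ) < n := by exact_mod_cast hn
  have hn1 : (1 : ℝ) ≤ n := by exact_mod_cast hn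
  unfold IsPorous at h
  push Not at h
  -- With 1/(2n), a gap of length l/n strictly exceeds the length allowed by the failure of
  -- porosity.
  obtain ⟨J, l, ⟨hl0, hl1, a, haJ, _⟩, hJ⟩ := h (1 / (2 * n)) (by positivity)
  refine ⟨Int.fract a, l, Int.fract_nonneg a, (Int.fract_lt_one a).le, hl0, hl1, fun s hs hs' => ?_⟩
  have hln : l / n ≤ 1 := by
    rw [div_le_one hn0]; linarith
  have hfr := Int.self_sub_floor a
  by_contra! hcon
  set s' := s + ⌊a⌋ with hs's
  have harc : IsArc (circlePt '' Set.Ioo s' (s' + l / n)) (l / n) :=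
    ⟨by positivity, hln, s', subset_rfl, Set.image_mono Set.Ioo_subset_Icc_self⟩
  have hle := hJ _ _ harc (by
    rintro _ ⟨t, ht, rfl⟩
    refine ⟨haJ ⟨t, ⟨by linarith [ht.1], by linarith [ht.2]⟩, rfl⟩, ?_⟩
    have h1 := hcon (t + (-⌊a⌋ : ℤ)) (by
      push_cast
      exact ⟨by linarith [ht.1], by linarith [ht.2]⟩)
    rwa [circlePt_add_int] at h1)
  have : 1 / (2 * n) * l < l / n := by
    rw [div_mul_eq_mul_div, one_mul, div_lt_div_iff₀ (by positivity) hn0]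
    nlinarith [mul_pos hl0 hn0]
  linarith

/-- A set which is not porous is almost dense in arcs which accumulate at some point but do not
contain it. -/
lemma exists_accumulation_of_not_isPorous {E : Set ℂ} (h : ¬ IsPorous E) :
    ∃ p : ℝ, ∀ n : ℕ, 1 ≤ n → ∀ η > 0, ∃ a l : ℝ, 0 < l ∧ p - η < a ∧ a + l < p + η ∧
      (p < a ∨ a + l < p) ∧ DenseOn E a l (l / n) := by
  -- Density to scale L/(k+1)^2 survives passing to an initial piece of length L/(k+1). The shorter
  -- pieces shrink to the limit of their left endpoints and keep relative density 1/(k+1).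
  choose a L ha0 ha1 hL0 hL1 hD using fun k : ℕ =>
    exists_denseOn_of_not_isPorous h (n := (k + 1) * (k + 1)) (by nlinarith)
  obtain ⟨p, _, φ, hφ, hp⟩ := isCompact_Icc.tendsto_subseq (s := Set.Icc (0 : ℝ) 1)
    (x := a) fun k => ⟨ha0 k, ha1 k⟩
  refine ⟨p, fun n hn η hη => ?_⟩
  have h1 : ∀ᶠ m in atTop, |a (φ m) - p| < η / 2 := by
    have := (Metric.tendsto_nhds.1 hp) (η / 2) (by positivity)
    simpa [Real.dist_eq] using this
  have h2 : ∀ᶠ m in atTop, 1 / (((φ m : ℕ) : ℝ) + 1) < η / 2 :=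
    (tendsto_one_div_add_atTop_nhds_zero_nat (𝕜 := ℝ)).comp hφ.tendsto_atTop |>.eventually_lt_const
      (by positivity)
  have h3 : ∀ᶠ m in atTop, 3 * n ≤ φ m := hφ.tendsto_atTop.eventually_ge_atTop _
  obtain ⟨m, hm1, hm2, hm3⟩ := (h1.and (h2.and h3)).exists
  set k := φ m
  have hk0 : (0 : ℝ) < (k : ℝ) + 1 := by positivity
  have hn0 : (0 : ℝ) < n := by exact_mod_cast hn
  set l := L k / (k + 1) with hl
  have hl0 : 0 < l := div_pos (hL0 k) hk0
  have hl1 : l < η / 2 := by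
    refine lt_of_le_of_lt ?_ hm2
    rw [hl]
    gcongr
    exact hL1 k
  have hlL : l ≤ L k := div_le_self (hL0 k).le (by linarith [(Nat.cast_nonneg k : (0 : ℝ) ≤ k)])
  have hd : L k / (((k + 1) * (k + 1) : ℕ) : ℝ) = l / (k + 1) := by
    rw [hl]; push_cast; field_simp
  have hD' := hD k
  rw [hd] at hD'
  clear_value l
  have hdd : l / (k + 1) ≤ l / 3 / n := by
    rw [div_div]
    refine div_le_div_of_nonneg_left hl0.le (by positivity) ?_
    have : ((3 * n : ℕ) : ℝ) ≤ k := by exact_mod_cast hm3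
    push_cast at this
    linarith
  rw [abs_lt] at hm1
  -- The first or the last third of the arc avoids p, according to the half in which p falls.
  rcases le_or_gt (a k + l / 2) p with hp' | hp'
  · refine ⟨a k, l / 3, by positivity, by linarith, by linarith, Or.inr (by linarith), ?_⟩
    exact hD'.mono le_rfl (by linarith) hdd
  · refine ⟨a k + 2 * l / 3, l / 3, by positivity, by linarith, by linarith, Or.inl (by linarith), ?_⟩
    exact hD'.mono (by linarith) (by linarith) hdd

/-- A choice of a rapidly converging sequence of such arcs. -/
lemma exists_seq_of_not_isPorous {E : Set ℂ} (h : ¬ IsPorous E) {w : ℕ → ℝ} (hw : ∀ k, 0 < w k)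
    {n : ℕ → ℕ} (hn : ∀ k, 1 ≤ n k) :
    ∃ (p : ℝ) (a l d : ℕ → ℝ), ∀ k, 0 < l k ∧ 0 < d k ∧ DenseOn E (a k) (l k) (l k / n k) ∧
      ∀ t ∈ Set.Icc (a k) (a k + l k), d k ≤ |t - p| ∧ |t - p| < w k ∧
        ∀ j < k, |t - p| < w k * l j ∧ |t - p| < w k * d j ^ 2 := by
  obtain ⟨p, hp⟩ := exists_accumulation_of_not_isPorous h
  have hex : ∀ k : ℕ, ∀ e : ℝ, ∃ a l d : ℝ, 0 < e → 0 < l ∧ 0 < d ∧ DenseOn E a l (l / n k) ∧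
      ∀ t ∈ Set.Icc a (a + l), d ≤ |t - p| ∧ |t - p| < w k * e := by
    intro k e
    by_cases he : 0 < e
    · obtain ⟨a, l, hl, h1, h2, h3, hD⟩ := hp (n k) (hn k) (w k * e) (mul_pos (hw k) he)
      rcases h3 with h3 | h3
      · refine ⟨a, l, a - p, fun _ => ⟨hl, by linarith, hD, fun t ht => ⟨?_, ?_⟩⟩⟩
        · exact le_trans (by linarith [ht.1]) (le_abs_self _)
        · exact abs_lt.2 ⟨by linarith [ht.1], by linarith [ht.2]⟩
      · refine ⟨a, l, p - (a + l), fun _ => ⟨hl, by linarith, hD, fun t ht => ⟨?_, ?_⟩⟩⟩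
        · exact le_trans (by linarith [ht.2]) (neg_le_abs _)
        · exact abs_lt.2 ⟨by linarith [ht.1], by linarith [ht.2]⟩
    · exact ⟨0, 0, 0, fun h => absurd h he⟩
  choose a l d hald using hex
  -- The running budget: e_(k+1) is at most every l_j and every d_j^2 with j ≤ k, and the k-th arc
  -- is chosen within w_k·e_k of p.
  set e : ℕ → ℝ := fun k => Nat.rec 1 (fun k e => min e (min (l k e) (d k e ^ 2))) k with he
  have he1 : ∀ k, e (k + 1) = min (e k) (min (l k (e k)) (d k (e k) ^ 2)) := fun k => rfl
  have hepos : ∀ k, 0 < e k := by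
    intro k
    induction k with
    | zero => exact one_pos
    | succ k ih =>
      rw [he1]
      exact lt_min ih (lt_min (hald k _ ih).1 (pow_pos (hald k _ ih).2.1 2))
  have hanti : Antitone e := antitone_nat_of_succ_le fun k => by
    rw [he1]; exact min_le_left _ _
  refine ⟨p, fun k => a k (e k), fun k => l k (e k), fun k => d k (e k), fun k => ?_⟩
  obtain ⟨h1, h2, h3, h4⟩ := hald k (e k) (hepos k)
  refine ⟨h1, h2, h3, fun t ht => ?_⟩
  obtain ⟨h5, h6⟩ := h4 t ht
  refine ⟨h5, h6.trans_le ?_, fun j hj => ?_⟩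
  · have : e k ≤ e 0 := hanti (Nat.zero_le k)
    have h0 : e 0 = 1 := rfl
    exact mul_le_of_le_one_right (hw k).le (by linarith)
  · have h7 : e k ≤ e (j + 1) := hanti hj
    rw [he1] at h7
    exact ⟨h6.trans_le (mul_le_mul_of_nonneg_left
        (h7.trans ((min_le_right _ _).trans (min_le_left _ _))) (hw k).le),
      h6.trans_le (mul_le_mul_of_nonneg_left
        (h7.trans ((min_le_right _ _).trans (min_le_right _ _))) (hw k).le)⟩

/-! ### Atomic singular inner functions -/

lemma countable_preimage_circlePt {F : Set ℂ} (hF : F.Countable) :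
    {t : ℝ | circlePt t ∈ F}.Countable := by
  have : {t : ℝ | circlePt t ∈ F} = ⋃ x ∈ F, {t | circlePt t = x} := by
    ext t; simp
  rw [this]
  refine hF.biUnion fun x _ => ?_
  by_cases hx : ∃ t₀, circlePt t₀ = x
  · obtain ⟨t₀, rfl⟩ := hx
    refine (Set.countable_range fun n : ℤ => t₀ + n).mono fun t ht => ?_
    have ht' : circlePt t = circlePt t₀ := ht
    unfold circlePt at ht'
    obtain ⟨n, hn⟩ := Complex.exp_eq_exp_iff_exists_int.1 ht'
    refine ⟨n, ?_⟩
    have h1 : (2 * Real.pi * Complex.I : ℂ) ≠ 0 := by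
      simp [Real.pi_ne_zero]
    have h2 : (t : ℂ) = t₀ + n := by
      apply mul_left_cancel₀ h1
      linear_combination hn
    exact_mod_cast h2.symm
  · have : {t | circlePt t = x} = ∅ := by
      ext t; simp only [Set.mem_ofPred_eq, Set.mem_empty_iff_false, iff_false]
      exact fun h => hx ⟨t, h⟩
    rw [this]
    exact Set.countable_empty

lemma re_div_eq_pker {x : ℂ} (hx : ‖x‖ = 1) (z : ℂ) : ((x + z) / (x - z)).re = pker z x := by
  have h := congrFun (poissonKernel_eq_re_herglotzRieszKernel (c := 0) (w := z)) x
  rw [poissonKernel_eq_pker hx] at h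
  simpa [herglotzRieszKernel] using h.symm

/-- The singular inner function of a summable family of point masses which accumulate at a single
point. -/
lemma exists_atomic_singularInner {ι : Type} [Countable ι] {m : ι → ℝ} (hm : ∀ i, 0 ≤ m i)
    (hms : Summable m) {x : ι → ℂ} (hx : ∀ i, ‖x i‖ = 1) {p : ℂ} (hp : ‖p‖ = 1)
    (hxp : Tendsto x cofinite (𝓝 p)) :
    ∃ S : ℂ → ℂ, IsSingularInner S ∧ sing S ⊆ insert p (Set.range x) ∧
      ∀ z ∈ disc, HasSum (fun i => m i * pker z (x i)) (-Real.log ‖S z‖) := by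
  set F := insert p (Set.range x) with hF
  have hFc : IsClosed F := hxp.isCompact_insert_range_of_cofinite.isClosed
  have hFd : ∀ y ∈ F, ‖y‖ = 1 := by
    rintro y (rfl | ⟨i, rfl⟩)
    exacts [hp, hx i]
  -- S will be exp(-H) with H the sum of these Herglotz kernels, which converges locally uniformly
  -- off F.
  set term : ι → ℂ → ℂ := fun i z => m i * ((x i + z) / (x i - z)) with hterm
  set H : ℂ → ℂ := fun z => ∑' i, term i z with hH
  have hloc : ∀ z ∉ F, ∃ r > 0, Summable (fun i => m i * ((1 + (‖z‖ + r)) / r)) ∧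
      ∀ w ∈ ball z r, ∀ i, x i - w ≠ 0 ∧ ‖term i w‖ ≤ m i * ((1 + (‖z‖ + r)) / r) := by
    intro z hz
    obtain ⟨r, hr, hball⟩ := Metric.isOpen_iff.1 hFc.isOpen_compl z hz
    refine ⟨r / 2, by positivity, hms.mul_right _, fun w hw i => ?_⟩
    have h1 : r ≤ ‖x i - z‖ := by
      by_contra! hlt
      have : x i ∈ ball z r := by rwa [mem_ball, dist_eq_norm]
      exact hball this (Set.mem_insert_of_mem _ ⟨i, rfl⟩)
    have h2 : ‖w - z‖ < r / 2 := by rwa [mem_ball, dist_eq_norm] at hw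
    have h3 : r / 2 ≤ ‖x i - w‖ := by
      have := norm_sub_le_norm_sub_add_norm_sub (x i) w z
      linarith
    have h4 : ‖w‖ ≤ ‖z‖ + r / 2 := by
      have := norm_sub_norm_le w z
      linarith
    refine ⟨norm_pos_iff.1 (by linarith), ?_⟩
    rw [hterm]
    simp only [norm_mul, norm_div, Complex.norm_real, Real.norm_of_nonneg (hm i)]
    have h5 : ‖x i + w‖ ≤ 1 + (‖z‖ + r / 2) := (norm_add_le _ _).trans (by rw [hx i]; linarith)
    have := hm i
    gcongr
  have hsum : ∀ z ∉ F, HasSum (fun i => term i z) (H z) := by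
    intro z hz
    obtain ⟨r, hr, hs, hb⟩ := hloc z hz
    exact (Summable.of_norm_bounded hs fun i => (hb z (mem_ball_self hr) i).2).hasSum
  have hdiff : ∀ z ∉ F, DifferentiableAt ℂ H z := by
    intro z hz
    obtain ⟨r, hr, hs, hb⟩ := hloc z hz
    have := Complex.differentiableOn_tsum_of_summable_norm hs (F := term) (U := ball z r)
      (fun i => ?_) isOpen_ball fun i w hw => (hb w hw i).2
    · exact this.differentiableAt (ball_mem_nhds z hr)
    · refine DifferentiableOn.const_mul (DifferentiableOn.div (by fun_prop) (by fun_prop) ?_) _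
      exact fun w hw => (hb w hw i).1
  have hre : ∀ z ∉ F, HasSum (fun i => m i * pker z (x i)) (H z).re := by
    intro z hz
    have e : (fun i => m i * pker z (x i)) = fun i => (term i z).re := by
      ext i
      rw [hterm, Complex.re_ofReal_mul, re_div_eq_pker (hx i)]
    rw [e]
    exact Complex.hasSum_re (hsum z hz)
  have hdiscF : ∀ z ∈ disc, z ∉ F := fun z hz hzF => by
    have h1 := mem_disc.1 hz
    rw [hFd z hzF] at h1
    exact lt_irrefl _ h1
  have hnorm : ∀ z, ‖Complex.exp (-H z)‖ = Real.exp (-(H z).re) := fun z => by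
    rw [Complex.norm_exp, Complex.neg_re]
  have hdS : ∀ z ∉ F, DifferentiableAt ℂ (fun z => Complex.exp (-H z)) z := fun z hz =>
    (hdiff z hz).neg.cexp
  refine ⟨fun z => Complex.exp (-H z), ⟨⟨?_, ?_, ?_⟩, ?_⟩, ?_, ?_⟩
  · exact fun z hz => (hdS z (hdiscF z hz)).differentiableWithinAt
  · refine ⟨1, fun z hz => ?_⟩
    rw [hnorm, Real.exp_le_one_iff, neg_nonpos]
    exact (hre z (hdiscF z hz)).nonneg fun i => mul_nonneg (hm i) (pker_pos hz (hx i)).le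
  -- F is countable, hence null. On the rest of the circle H is analytic and every Poisson kernel
  -- vanishes, so |S| = 1.
  · have hnull : ∀ᵐ t : ℝ, circlePt t ∉ F := by
      rw [MeasureTheory.ae_iff]
      simp only [not_not]
      exact (countable_preimage_circlePt ((Set.countable_range x).insert p)).measure_zero _
    filter_upwards [hnull] with t ht
    refine ⟨Complex.exp (-H (circlePt t)), ?_, ?_⟩
    · have h0 : gap (circlePt t) = 0 := by simp [gap, norm_circlePt]
      have h1 := hre _ ht
      simp only [pker, h0, zero_div, mul_zero] at h1
      rw [hnorm, h1.unique hasSum_zero]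
      simp
    · exact (hdS _ ht).continuousAt.tendsto.comp (tendsto_ofReal_mul_nhdsLT_one _)
  · ext z
    simp [zeroSet, Complex.exp_ne_zero]
  · rintro ζ ⟨_, hζ⟩
    by_contra hζF
    refine hζ ⟨fun z => Complex.exp (-H z), ?_, Eventually.of_forall fun _ => rfl⟩
    have : DifferentiableOn ℂ (fun z => Complex.exp (-H z)) Fᶜ := fun z hz =>
      (hdS z hz).differentiableWithinAt
    exact this.analyticAt (hFc.isOpen_compl.mem_nhds hζF)
  · intro z hz
    rw [hnorm, Real.log_exp, neg_neg]
    exact hre z (hdiscF z hz)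

/-! ### Many zeros below an arc -/

/-- The dyadic net below the arc with parameters in `[a, a + l]`. -/
noncomputable def netPt (a l : ℝ) (s j : ℕ) : ℂ :=
  ((1 - l / 2 ^ s : ℝ) : ℂ) * circlePt (a + j * (l / 2 ^ s))

lemma one_sub_norm_netPt {a l : ℝ} (hl0 : 0 < l) (hl1 : l ≤ 1 / 2) (s j : ℕ) :
    1 - ‖netPt a l s j‖ = l / 2 ^ s := by
  have h : l / 2 ^ s ≤ l := div_le_self hl0.le (one_le_pow₀ (by norm_num))
  rw [netPt, norm_mul_circlePt (by linarith)]
  ring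

lemma netPt_mem_disc {a l : ℝ} (hl0 : 0 < l) (hl1 : l ≤ 1 / 2) (s j : ℕ) :
    netPt a l s j ∈ disc := by
  have h := one_sub_norm_netPt (a := a) hl0 hl1 s j
  have : 0 < l / 2 ^ s := by positivity
  rw [mem_disc]; linarith

lemma norm_circlePt_sub_netPt {a l : ℝ} (hl0 : 0 < l) (s j : ℕ) :
    ‖circlePt (a + j * (l / 2 ^ s)) - netPt a l s j‖ = l / 2 ^ s := by
  have : 0 < l / 2 ^ s := by positivity
  rw [netPt, norm_circlePt_sub_mul (by linarith)]
  ring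

lemma nat_mul_div_le {l : ℝ} (hl0 : 0 < l) {s j : ℕ} (hj : j < 2 ^ s) : j * (l / 2 ^ s) ≤ l := by
  have : (j : ℝ) ≤ 2 ^ s := by exact_mod_cast hj.le
  calc j * (l / 2 ^ s) ≤ 2 ^ s * (l / 2 ^ s) := by gcongr
    _ = l := by field_simp

/-- Points close to different points of the net are different. -/
lemma netPt_separated {a l : ℝ} (hl0 : 0 < l) (hl1 : l ≤ 1 / 2) {s j s' j' : ℕ} (hj : j < 2 ^ s)
    (hj' : j' < 2 ^ s') {b : ℂ} (hb : ‖b - netPt a l s j‖ < l / 2 ^ s / 3)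
    (hb' : ‖b - netPt a l s' j'‖ < l / 2 ^ s' / 3) : s = s' ∧ j = j' := by
  -- Being close to a net point of level s puts 1 - |b| strictly between 2/3 and 4/3 of l/2^s; these
  -- ranges are disjoint for different levels. Within one level the net points are at least 2l/2^s
  -- apart.
  have hlt : ∀ {s j s' j' : ℕ}, ‖b - netPt a l s j‖ < l / 2 ^ s / 3 →
      ‖b - netPt a l s' j'‖ < l / 2 ^ s' / 3 → ¬ s < s' := by
    intro s j s' j' hb hb' hss
    have h1 := one_sub_norm_netPt (a := a) hl0 hl1 s j
    have h2 := one_sub_norm_netPt (a := a) hl0 hl1 s' j'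
    have h3 := abs_norm_sub_norm_le b (netPt a l s j)
    have h4 := abs_norm_sub_norm_le b (netPt a l s' j')
    rw [abs_le] at h3 h4
    have h5 : 2 * (l / 2 ^ s') ≤ l / 2 ^ s := by
      obtain ⟨k, rfl⟩ := Nat.exists_eq_add_of_lt hss
      have : 2 * (l / 2 ^ (s + k + 1)) = l / 2 ^ s / 2 ^ k := by
        rw [pow_succ, pow_add]; field_simp
      rw [this]
      exact div_le_self (by positivity) (one_le_pow₀ (by norm_num))
    linarith
  have hss : s = s' := le_antisymm (not_lt.1 (hlt hb' hb)) (not_lt.1 (hlt hb hb'))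
  subst hss
  refine ⟨rfl, ?_⟩
  by_contra hne
  set h := l / 2 ^ s with hh
  have hh0 : 0 < h := by positivity
  have hhl : h ≤ l := div_le_self hl0.le (one_le_pow₀ (by norm_num))
  have h1 : ‖netPt a l s j - netPt a l s j'‖ < 2 * h / 3 := by
    have := norm_sub_le_norm_sub_add_norm_sub (netPt a l s j) b (netPt a l s j')
    rw [norm_sub_rev _ b] at this
    linarith
  have h2 : ‖netPt a l s j - netPt a l s j'‖
      = (1 - h) * ‖circlePt (a + j * h) - circlePt (a + j' * h)‖ := by
    unfold netPt
    rw [← mul_sub, norm_mul, Complex.norm_real, Real.norm_of_nonneg (by linarith)]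
  have h3 : |(a + j * h) - (a + j' * h)| = |(j : ℝ) - j'| * h := by
    rw [← abs_of_pos hh0, ← abs_mul, abs_of_pos hh0]; congr 1; ring
  have h4 : |(a + j * h) - (a + j' * h)| ≤ 1 / 2 := by
    have e1 := nat_mul_div_le hl0 hj
    have e2 := nat_mul_div_le hl0 hj'
    have e3 : 0 ≤ (j : ℝ) * h := by positivity
    have e4 : 0 ≤ (j' : ℝ) * h := by positivity
    exact abs_le.2 ⟨by linarith, by linarith⟩
  have h5 := le_norm_circlePt_sub h4
  have h6 : 1 ≤ |(j : ℝ) - j'| := by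
    have : (1 : ℤ) ≤ |(j : ℤ) - j'| := Int.one_le_abs (by omega)
    exact_mod_cast this
  rw [h3] at h5
  nlinarith

/-- From r ≤ e^(r-1) and r - 1 ≤ -(1 - r^2)/2, the latter being (1 - r)^2 ≥ 0. -/
lemma le_exp_half {r : ℝ} : r ≤ Real.exp (-((1 - r ^ 2) / 2)) := by
  have h1 := Real.add_one_le_exp (r - 1)
  have h2 : r - 1 ≤ -((1 - r ^ 2) / 2) := by nlinarith [sq_nonneg (1 - r)]
  have := Real.exp_le_exp.2 h2
  linarith

/-- If a Blaschke product has a zero close to every point of the net, it is small above the arc. -/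
lemma norm_le_exp_of_net {a l A : ℝ} {N : ℕ} (hl0 : 0 < l) (hA : 9 ≤ A) (hAl : A * l ≤ 1 / 2)
    {ι : Type} {f : ι → ℂ} (hf : ∀ i, f i ∈ disc) {B : ℂ}
    (hB : HasProd (fun i => blaschkeFactor (f i) (((1 - A * l : ℝ) : ℂ) * circlePt a)) B)
    (hnet : ∀ s < N, ∀ j < 2 ^ s, ∃ i, ‖f i - netPt a l s j‖ < l / 2 ^ s / 3) :
    ‖B‖ ≤ Real.exp (-(N / (18 * A))) := by
  classical
  set z : ℂ := ((1 - A * l : ℝ) : ℂ) * circlePt a with hz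
  have hAl0 : 0 < A * l := by positivity
  have hl1 : l ≤ 1 / 2 := by nlinarith
  have hzn : ‖z‖ = 1 - A * l := norm_mul_circlePt (by linarith) a
  have hzd : z ∈ disc := by rw [mem_disc]; linarith
  rcases isEmpty_or_nonempty ι with hι | hι
  · obtain rfl : N = 0 := by
      by_contra hN
      obtain ⟨i, _⟩ := hnet 0 (Nat.pos_of_ne_zero hN) 0 (by norm_num)
      exact hι.elim i
    simpa using norm_le_prod_rho hf hzd hB ∅
  have hex : ∀ q : Σ _ : ℕ, ℕ, ∃ i : ι, q ∈ (Finset.range N).sigma (fun s => Finset.range (2 ^ s)) →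
      ‖f i - netPt a l q.1 q.2‖ < l / 2 ^ q.1 / 3 := by
    rintro ⟨s, j⟩
    by_cases h : s < N ∧ j < 2 ^ s
    · obtain ⟨i, hi⟩ := hnet s h.1 j h.2
      exact ⟨i, fun _ => hi⟩
    · exact ⟨Classical.arbitrary ι, fun h' => absurd (by simpa using h') h⟩
  choose g hg using hex
  set T := (Finset.range N).sigma (fun s => Finset.range (2 ^ s)) with hT
  have hinj : Set.InjOn g T := by
    rintro ⟨s, j⟩ hq ⟨s', j'⟩ hq' heq
    have h1 := hg _ hq
    have h2 := hg _ hq'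
    rw [heq] at h1
    simp only [hT, Finset.coe_sigma, Set.mem_sigma_iff, Finset.mem_coe, Finset.mem_range] at hq hq'
    obtain ⟨rfl, rfl⟩ := netPt_separated hl0 hl1 hq.2 hq'.2 h1 h2
    rfl
  -- Here 1 - ρ^2 ≥ (2h/3)(Al) / (6(Al)^2) with h = l/2^s. The 2^s points of a level therefore
  -- contribute 1/(9A) together, whatever the level.
  have hrho : ∀ q ∈ T, 1 / (9 * A) / 2 ^ q.1 ≤ 1 - rho z (f (g q)) ^ 2 := by
    rintro ⟨s, j⟩ hq
    have hb := hg _ hq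
    simp only [hT, Finset.mem_sigma, Finset.mem_range] at hq
    simp only at hb ⊢
    set b := f (g ⟨s, j⟩) with hbdef
    have hbd : b ∈ disc := hf _
    set h := l / 2 ^ s with hh
    have hh0 : 0 < h := by positivity
    have hhl : h ≤ l := div_le_self hl0.le (one_le_pow₀ (by norm_num))
    have h1 := one_sub_norm_netPt (a := a) hl0 hl1 s j
    have h2 := abs_norm_sub_norm_le b (netPt a l s j)
    rw [abs_le] at h2
    have hg1 : 2 / 3 * h ≤ gap b := by
      have := one_sub_norm_le_gap (mem_disc.1 hbd).le
      linarith
    have hg2 : gap b ≤ A * l := by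
      have := gap_le_two_mul b
      nlinarith
    have hg3 : A * l ≤ gap z := by
      have := one_sub_norm_le_gap (mem_disc.1 hzd).le
      linarith
    have hg4 : gap z ≤ 2 * (A * l) := by
      have := gap_le_two_mul z
      linarith
    have hzb : ‖z - b‖ ≤ 2 * (A * l) := by
      have e1 := norm_circlePt_sub_mul (r := 1 - A * l) (by linarith) a
      have e2 := norm_circlePt_sub_le (a + j * h) a
      have e3 := norm_circlePt_sub_netPt (a := a) hl0 s j
      have e4 := nat_mul_div_le hl0 hq.2
      have e5 := norm_sub_le_norm_sub_add_norm_sub b (netPt a l s j) (circlePt (a + j * h))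
      have e6 := norm_sub_le_norm_sub_add_norm_sub b (circlePt (a + j * h)) (circlePt a)
      have e7 := norm_sub_le_norm_sub_add_norm_sub b (circlePt a) z
      have e8 : |a + j * h - a| ≤ l := by
        rw [add_sub_cancel_left, abs_of_nonneg (by positivity)]
        exact e4
      rw [norm_sub_rev (netPt a l s j)] at e5
      rw [norm_sub_rev z b]
      have e9 : 9 * l ≤ A * l := by gcongr
      linarith
    have hden : ‖1 - conj b * z‖ ^ 2 ≤ 6 * (A * l) ^ 2 := by
      rw [norm_one_sub_conj_mul_sq]
      have e1 : ‖z - b‖ ^ 2 ≤ (2 * (A * l)) ^ 2 := by gcongr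
      have e2 : gap z * gap b ≤ 2 * (A * l) * (A * l) :=
        mul_le_mul hg4 hg2 (gap_pos hbd).le (by positivity)
      linarith
    rw [one_sub_rho_sq_eq hzd hbd]
    have hpos := norm_pos_iff.2 (one_sub_conj_mul_ne_zero hbd (mem_disc.1 hzd).le)
    rw [le_div_iff₀ (by positivity)]
    calc 1 / (9 * A) / 2 ^ s * ‖1 - conj b * z‖ ^ 2
        ≤ 1 / (9 * A) / 2 ^ s * (6 * (A * l) ^ 2) := by gcongr
      _ = 2 / 3 * h * (A * l) := by rw [hh]; field_simp; norm_num
      _ ≤ _ := mul_le_mul hg1 hg3 hAl0.le (gap_pos hbd).le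
  have hsum : (N : ℝ) / (9 * A) ≤ ∑ q ∈ T, (1 - rho z (f (g q)) ^ 2) := by
    refine le_trans (le_of_eq ?_) (Finset.sum_le_sum hrho)
    rw [hT, Finset.sum_sigma]
    have : ∀ s ∈ Finset.range N, ∑ _j ∈ Finset.range (2 ^ s), 1 / (9 * A) / 2 ^ s = 1 / (9 * A) := by
      intro s _
      rw [Finset.sum_const, Finset.card_range, nsmul_eq_mul]
      push_cast
      field_simp
    simp only
    rw [Finset.sum_congr rfl this, Finset.sum_const, Finset.card_range, nsmul_eq_mul]
    ring
  refine (norm_le_prod_rho hf hzd hB (T.image g)).trans ?_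
  rw [Finset.prod_image hinj]
  calc ∏ q ∈ T, rho z (f (g q)) ≤ ∏ q ∈ T, Real.exp (-((1 - rho z (f (g q)) ^ 2) / 2)) :=
        Finset.prod_le_prod (fun q _ => rho_nonneg _ _) fun q _ => le_exp_half
    _ = Real.exp (-((∑ q ∈ T, (1 - rho z (f (g q)) ^ 2)) / 2)) := by
        rw [← Real.exp_sum, Finset.sum_neg_distrib, Finset.sum_div]
    _ ≤ _ := by
        rw [Real.exp_le_exp, neg_le_neg_iff]
        have : (N : ℝ) / (18 * A) = N / (9 * A) / 2 := by field_simp; ring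
        rw [this]
        gcongr

/-- Evenly distributed point masses produce a large Poisson integral at the points of the net. -/
lemma le_sum_pker_netPt {a l c : ℝ} {N : ℕ} (hl0 : 0 < l) (hl1 : l ≤ 1 / 2) (hc : 0 ≤ c)
    {t : Fin (2 ^ N) → ℝ}
    (ht : ∀ i : Fin (2 ^ N),
      t i ∈ Set.Icc (a + (i : ℕ) * (l / 2 ^ N)) (a + (i : ℕ) * (l / 2 ^ N) + l / 2 ^ N))
    {s j : ℕ} (hs : s ≤ N) (hj : j < 2 ^ s) :
    c / 64 ≤ ∑ i, c * l / 2 ^ N * pker (netPt a l s j) (circlePt (t i)) := by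
  classical
  obtain ⟨k, rfl⟩ := Nat.exists_eq_add_of_le hs
  set h := l / 2 ^ s with hh
  have hh0 : 0 < h := by positivity
  have hd := netPt_mem_disc (a := a) hl0 hl1 s j
  -- The 2^k atoms over the j-th subarc of length h = l/2^s are within 8h of the net point. Their
  -- total mass is ch, so they alone give c/64.
  have hlow : ∀ i : Fin (2 ^ (s + k)), j * 2 ^ k ≤ (i : ℕ) → (i : ℕ) < (j + 1) * 2 ^ k →
      1 / (64 * h) ≤ pker (netPt a l s j) (circlePt (t i)) := by
    intro i hi1 hi2
    have hi1' : (j : ℝ) * 2 ^ k ≤ (i : ℕ) := by exact_mod_cast hi1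
    have hi2' : ((i : ℕ) : ℝ) + 1 ≤ (j + 1) * 2 ^ k := by exact_mod_cast hi2
    have hstep : l / 2 ^ (s + k) * 2 ^ k = h := by rw [hh, pow_add]; field_simp
    have hst0 : 0 < l / 2 ^ (s + k) := by positivity
    have h1 : (j : ℝ) * h ≤ (i : ℕ) * (l / 2 ^ (s + k)) := by
      rw [← hstep]; nlinarith
    have h2 : (i : ℕ) * (l / 2 ^ (s + k)) + l / 2 ^ (s + k) ≤ (j + 1) * h := by
      rw [← hstep]; nlinarith
    have h3 : |t i - (a + j * h)| ≤ h :=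
      abs_le.2 ⟨by linarith [(ht i).1], by linarith [(ht i).2]⟩
    have h4 := norm_circlePt_sub_le (t i) (a + j * h)
    have h5 := norm_circlePt_sub_netPt (a := a) hl0 s j
    have h6 := norm_sub_le_norm_sub_add_norm_sub (circlePt (t i)) (circlePt (a + j * h))
      (netPt a l s j)
    have h7 : ‖circlePt (t i) - netPt a l s j‖ ≤ 8 * h := by linarith
    have h8 := one_sub_norm_le_gap (mem_disc.1 hd).le
    rw [one_sub_norm_netPt hl0 hl1] at h8
    have h9 := norm_sub_pos_of_norm_eq_one hd (norm_circlePt (t i))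
    unfold pker
    calc 1 / (64 * h) = h / (8 * h) ^ 2 := by field_simp; norm_num
      _ ≤ gap (netPt a l s j) / ‖circlePt (t i) - netPt a l s j‖ ^ 2 := by
        have := (gap_pos hd).le
        gcongr
  set T : Finset (Fin (2 ^ (s + k))) :=
    Finset.univ.filter fun i => j * 2 ^ k ≤ (i : ℕ) ∧ (i : ℕ) < (j + 1) * 2 ^ k with hT
  have hcard : 2 ^ k ≤ T.card := by
    have hjk : (j + 1) * 2 ^ k ≤ 2 ^ (s + k) := by
      rw [pow_add]; exact Nat.mul_le_mul_right _ hj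
    have hsub : Finset.Ico (j * 2 ^ k) ((j + 1) * 2 ^ k) ⊆ T.image Fin.val := by
      intro i hi
      rw [Finset.mem_Ico] at hi
      exact Finset.mem_image.2 ⟨⟨i, hi.2.trans_le hjk⟩, by simpa [hT] using hi, rfl⟩
    have := (Finset.card_le_card hsub).trans Finset.card_image_le
    rw [Nat.card_Ico, ← Nat.sub_mul] at this
    simpa using this
  calc c / 64 = ∑ _i ∈ Finset.range (2 ^ k), c * l / 2 ^ (s + k) * (1 / (64 * h)) := by
        rw [Finset.sum_const, Finset.card_range, nsmul_eq_mul, hh, pow_add]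
        push_cast
        field_simp
    _ = (2 ^ k : ℕ) * (c * l / 2 ^ (s + k) * (1 / (64 * h))) := by
        rw [Finset.sum_const, Finset.card_range, nsmul_eq_mul]
    _ ≤ T.card * (c * l / 2 ^ (s + k) * (1 / (64 * h))) := by
        have : ((2 ^ k : ℕ) : ℝ) ≤ T.card := by exact_mod_cast hcard
        gcongr
    _ = ∑ _i ∈ T, c * l / 2 ^ (s + k) * (1 / (64 * h)) := by
        rw [Finset.sum_const, nsmul_eq_mul]
    _ ≤ ∑ i ∈ T, c * l / 2 ^ (s + k) * pker (netPt a l s j) (circlePt (t i)) := by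
        refine Finset.sum_le_sum fun i hi => ?_
        have hi' := (Finset.mem_filter.1 hi).2
        have := hlow i hi'.1 hi'.2
        gcongr
    _ ≤ _ := Finset.sum_le_univ_sum_of_nonneg fun i =>
        mul_nonneg (by positivity) (pker_pos hd (norm_circlePt _)).le

/-- The denominator 1 - conj w · b is at most gap w + |b - w|, so ρ < 1/7 gives |b - w| < gap w / 6
≤ (1 - |w|)/3, the radius used in `netPt_separated`. -/
lemma norm_sub_lt_of_rho_lt {w b : ℂ} (hw : w ∈ disc) (hb : b ∈ disc) (h : rho w b < 1 / 7) :
    ‖b - w‖ < (1 - ‖w‖) / 3 := by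
  rw [rho_comm] at h
  have hne := norm_pos_iff.2 (one_sub_conj_mul_ne_zero hw (mem_disc.1 hb).le)
  unfold rho at h
  rw [norm_div, div_lt_iff₀ hne] at h
  have h1 : 1 - conj w * b = ((gap w : ℝ) : ℂ) + conj w * (w - b) := by
    rw [mul_sub, Complex.conj_mul']
    simp only [gap]
    push_cast
    ring
  have h2 : ‖1 - conj w * b‖ ≤ gap w + ‖b - w‖ := by
    rw [h1]
    refine (norm_add_le _ _).trans ?_
    rw [norm_mul, RCLike.norm_conj, Complex.norm_real, Real.norm_of_nonneg (gap_pos hw).le,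
      norm_sub_rev]
    nlinarith [norm_nonneg (b - w), mem_disc.1 hw]
  have h3 := gap_le_two_mul w
  linarith

/-! ### A singular inner function which is not easily wepable -/

/-- Spreads v k evenly over 2^(N k) indices; it serves both for the masses of the atoms and for the
majorant of u. -/
lemma hasSum_sigma_fin {N : ℕ → ℕ} {v : ℕ → ℝ} (hv : ∀ k, 0 ≤ v k) {V : ℝ} (h : HasSum v V) :
    HasSum (fun i : Σ k, Fin (2 ^ N k) => v i.1 / 2 ^ N i.1) V := by
  have h1 : ∀ k, HasSum (fun _ : Fin (2 ^ N k) => v k / 2 ^ N k) (v k) := by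
    intro k
    have := hasSum_fintype (fun _ : Fin (2 ^ N k) => v k / 2 ^ N k)
    rw [Finset.sum_const, Finset.card_univ, Fintype.card_fin, nsmul_eq_mul] at this
    push_cast at this
    rwa [mul_div_cancel₀ _ (by positivity)] at this
  have hs : Summable (fun i : Σ k, Fin (2 ^ N k) => v i.1 / 2 ^ N i.1) := by
    rw [summable_sigma_of_nonneg fun i => div_nonneg (hv _) (by positivity)]
    exact ⟨fun k => (h1 k).summable, h.summable.congr fun k => (h1 k).tsum_eq.symm⟩
  exact HasSum.sigma_of_hasSum h h1 hs

/-- The pole stays at distance at least d from the point, whose gap is at most 2Al ≤ 4Aw·d^2. -/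
lemma pker_le_of_far {p a l A w d t : ℝ} (hA : 0 < A) (hl : 0 < l) (hAl : A * l ≤ 1 / 4)
    (hw : 0 ≤ w) (hw8 : w ≤ 1 / 8) (hAw : 4 * A * w ≤ 1 / 2) (hd : 0 < d) (ht : d ≤ |t - p|)
    (ht' : |t - p| < 1 / 8) (ha : |a - p| < w * d ^ 2) (hlw : l < 2 * (w * d ^ 2)) :
    pker (((1 - A * l : ℝ) : ℂ) * circlePt a) (circlePt t) ≤ 4 * A * w := by
  set z : ℂ := ((1 - A * l : ℝ) : ℂ) * circlePt a with hz
  have hAl0 : 0 < A * l := mul_pos hA hl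
  have hzn : ‖z‖ = 1 - A * l := norm_mul_circlePt (by linarith) _
  have hgz2 : gap z ≤ 2 * (A * l) := by
    have := gap_le_two_mul z
    linarith
  have hdd : d ^ 2 ≤ d := by nlinarith
  have hwd : w * d ^ 2 ≤ d / 8 := by nlinarith
  have e1 : 7 / 8 * d ≤ |t - a| := by
    have := abs_sub_abs_le_abs_sub (t - p) (a - p)
    rw [sub_sub_sub_cancel_right] at this
    linarith
  have e2 : |t - a| ≤ 1 / 2 := by
    have := abs_sub (t - p) (a - p)
    rw [sub_sub_sub_cancel_right] at this
    linarith
  have e3 := le_norm_circlePt_sub e2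
  have e4 : ‖circlePt a - z‖ = A * l := by
    rw [hz, norm_circlePt_sub_mul (by linarith)]; ring
  have e5 : A * l ≤ 4 * A * w * d ^ 2 / 2 := by nlinarith
  have h4 : 0 ≤ 4 * A * w := by positivity
  have e6 : 4 * A * w * d ^ 2 ≤ d := by nlinarith
  have e7 := norm_sub_le_norm_sub_add_norm_sub (circlePt t) z (circlePt a)
  rw [norm_sub_rev z] at e7
  have e8 : d ≤ ‖circlePt t - z‖ := by linarith
  unfold pker
  have h0 : 0 < ‖circlePt t - z‖ := hd.trans_le e8
  rw [div_le_iff₀ (by positivity)]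
  have h3 : d ^ 2 ≤ ‖circlePt t - z‖ ^ 2 := by gcongr
  nlinarith

set_option maxHeartbeats 1000000 in
/-- If `E` is not porous, there is an atomic singular inner function with singular set in `E` which
is small on long dyadic nets, but not small just above them. -/
lemma exists_singularInner_of_not_isPorous {E : Set ℂ} (hE : IsClosed E) (h : ¬ IsPorous E) :
    ∃ S, IsSingularInner S ∧ sing S ⊆ E ∧ ∀ k : ℕ, ∃ (a l A : ℝ) (N : ℕ),
      0 < l ∧ 9 ≤ A ∧ A * l ≤ 1 / 2 ∧ (k + 1 : ℝ) ≤ N / (18 * A) ∧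
      (∀ s < N, ∀ j < 2 ^ s, (k + 1 : ℝ) ≤ -Real.log ‖S (netPt a l s j)‖) ∧
      ∀ b ∈ disc, rho b (((1 - A * l : ℝ) : ℂ) * circlePt a) ≤ 1 / 2 →
        -Real.log ‖S b‖ ≤ 3 / (k + 1) := by
  -- The constants: 1/P is a weight of total sum 1; c = 64κ gives u ≥ κ on the net; A makes the k-th
  -- arc contribute 1/(κP) at z_k; N/(18A) ≥ κ; and w makes 4Aw = 1/(κP), the bound for the kernel
  -- at far atoms.
  set κ : ℕ → ℝ := fun k => k + 1 with hκ
  have hκ1 : ∀ k, 1 ≤ κ k := fun k => by simp [hκ]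
  have hκ0 : ∀ k, 0 < κ k := fun k => zero_lt_one.trans_le (hκ1 k)
  set P : ℕ → ℝ := fun k => 2 ^ (k + 1) with hP
  have hP2 : ∀ k, 2 ≤ P k := fun k => by
    simp only [hP, pow_succ]
    have : (1 : ℝ) ≤ 2 ^ k := one_le_pow₀ (by norm_num)
    linarith
  have hP0 : ∀ k, 0 < P k := fun k => by linarith [hP2 k]
  set c : ℕ → ℝ := fun k => 64 * κ k with hc
  have hc0 : ∀ k, 0 < c k := fun k => mul_pos (by norm_num) (hκ0 k)
  set A : ℕ → ℝ := fun k => 4 * c k * κ k * P k with hA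
  have hA0 : ∀ k, 0 < A k := fun k => by
    have := hc0 k; have := hκ0 k; have := hP0 k
    simp only [hA]; positivity
  have hκP : ∀ k, 1 ≤ κ k * P k := fun k => by nlinarith [hκ1 k, hP2 k]
  have hAc : ∀ k, 4 * c k ≤ A k := fun k => by
    have := hκP k; have := hc0 k
    simp only [hA]; nlinarith
  have hAκ : ∀ k, 256 * κ k ≤ A k := fun k => by
    have := hAc k
    simp only [hc] at this
    linarith
  set N : ℕ → ℕ := fun k => ⌈18 * A k * κ k⌉₊ with hN
  set w : ℕ → ℝ := fun k => 1 / (4 * A k * κ k * P k) with hw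
  have hw0 : ∀ k, 0 < w k := fun k => by
    have := hA0 k; have := hκ0 k; have := hP0 k
    simp only [hw]; positivity
  have hAw : ∀ k, 4 * A k * w k = 1 / (κ k * P k) := fun k => by
    have := hA0 k; have := hκ0 k; have := hP0 k
    simp only [hw]; field_simp
  have hAw2 : ∀ k, 4 * A k * w k ≤ 1 / P k := fun k => by
    rw [hAw]
    have := hP0 k
    gcongr
    nlinarith [hκ1 k]
  have hAw3 : ∀ k, 4 * A k * w k ≤ 1 / κ k := fun k => by
    rw [hAw]
    have := hκ0 k
    gcongr
    nlinarith [hP2 k]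
  have hPhalf : ∀ k, 1 / P k ≤ 1 / 2 := fun k => by
    have := hP2 k
    gcongr
  have hwP : ∀ k, w k ≤ 1 / P k / 8 := fun k => by
    have h1 := hAw2 k
    have h2 := hAκ k
    have h3 := hκ1 k
    have h4 := hw0 k
    nlinarith
  have hcw : ∀ k, 4 * c k * w k ≤ 1 / P k := fun k => by
    have h1 := hAw2 k
    have h2 := hAc k
    have h4 := hw0 k
    nlinarith [hc0 k]
  obtain ⟨p, a, l, d, hseq⟩ := exists_seq_of_not_isPorous h hw0 (n := fun k => 2 ^ N k)
    fun k => Nat.one_le_two_pow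
  have hl0 : ∀ k, 0 < l k := fun k => (hseq k).1
  have hd0 : ∀ k, 0 < d k := fun k => (hseq k).2.1
  have ha_mem : ∀ k, a k ∈ Set.Icc (a k) (a k + l k) := fun k =>
    ⟨le_rfl, by linarith [hl0 k]⟩
  have hal_mem : ∀ k, a k + l k ∈ Set.Icc (a k) (a k + l k) := fun k =>
    ⟨by linarith [hl0 k], le_rfl⟩
  have hl_lt : ∀ k r, |a k - p| < r → |a k + l k - p| < r → l k < 2 * r := by
    intro k r h1 h2
    rw [abs_lt] at h1 h2
    linarith
  have hlw : ∀ k, l k < 2 * w k := fun k => hl_lt k _ ((hseq k).2.2.2 _ (ha_mem k)).2.1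
    ((hseq k).2.2.2 _ (hal_mem k)).2.1
  have hll : ∀ k, ∀ j < k, l k < 2 * (w k * l j) := fun k j hj =>
    hl_lt k _ (((hseq k).2.2.2 _ (ha_mem k)).2.2 j hj).1
      (((hseq k).2.2.2 _ (hal_mem k)).2.2 j hj).1
  have hld : ∀ k, ∀ j < k, l k < 2 * (w k * d j ^ 2) := fun k j hj =>
    hl_lt k _ (((hseq k).2.2.2 _ (ha_mem k)).2.2 j hj).2
      (((hseq k).2.2.2 _ (hal_mem k)).2.2 j hj).2
  have hAl : ∀ k, A k * l k ≤ 1 / 4 := fun k => by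
    have h1 := hAw2 k
    have h2 := hPhalf k
    have h3 := hlw k
    have h4 := hA0 k
    nlinarith
  have hcl : ∀ k, c k * l k ≤ 1 / P k := fun k => by
    have h1 := hcw k
    have h3 := hlw k
    have h4 := hc0 k
    have := mul_pos h4 (hw0 k)
    nlinarith
  have hex : ∀ k, ∀ i : Fin (2 ^ N k), ∃ t ∈ Set.Icc (a k + (i : ℕ) * (l k / 2 ^ N k))
      (a k + (i : ℕ) * (l k / 2 ^ N k) + l k / 2 ^ N k), circlePt t ∈ E := by
    intro k i
    have hD := (hseq k).2.2.1
    push_cast at hD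
    have hst : 0 < l k / 2 ^ N k := div_pos (hl0 k) (by positivity)
    refine hD _ (le_add_of_nonneg_right (by positivity)) ?_
    have h1 : ((i : ℕ) : ℝ) + 1 ≤ 2 ^ N k := by exact_mod_cast i.2
    have h2 : (2 : ℝ) ^ N k * (l k / 2 ^ N k) = l k := by field_simp
    nlinarith
  choose t ht htE using hex
  have ht_mem : ∀ k i, t k i ∈ Set.Icc (a k) (a k + l k) := by
    intro k i
    have hst : 0 < l k / 2 ^ N k := div_pos (hl0 k) (by positivity)
    have h1 : ((i : ℕ) : ℝ) + 1 ≤ 2 ^ N k := by exact_mod_cast i.2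
    have h2 : (2 : ℝ) ^ N k * (l k / 2 ^ N k) = l k := by field_simp
    have h3 : 0 ≤ ((i : ℕ) : ℝ) * (l k / 2 ^ N k) := by positivity
    have := ht k i
    exact ⟨by linarith [this.1], by nlinarith [this.2]⟩
  have htp : ∀ k i, d k ≤ |t k i - p| ∧ |t k i - p| < w k := fun k i =>
    ⟨((hseq k).2.2.2 _ (ht_mem k i)).1, ((hseq k).2.2.2 _ (ht_mem k i)).2.1⟩
  have hwt : Tendsto w atTop (𝓝 0) := by
    have h1 : Tendsto (fun k : ℕ => (1 / 2 : ℝ) ^ k) atTop (𝓝 0) :=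
      tendsto_pow_atTop_nhds_zero_of_lt_one (by norm_num) (by norm_num)
    refine squeeze_zero (fun k => (hw0 k).le) (fun k => ?_) h1
    refine (hwP k).trans ?_
    simp only [hP, pow_succ, one_div, inv_pow, mul_inv]
    have : (0 : ℝ) < ((2 : ℝ) ^ k)⁻¹ := by positivity
    linarith
  set x : (Σ k, Fin (2 ^ N k)) → ℂ := fun i => circlePt (t i.1 i.2) with hx
  have hx1 : ∀ i, ‖x i‖ = 1 := fun i => norm_circlePt _
  have hxp : Tendsto x cofinite (𝓝 (circlePt p)) := by
    refine (continuous_circlePt.tendsto p).comp (f := fun i : Σ k, Fin (2 ^ N k) => t i.1 i.2) ?_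
    rw [Metric.tendsto_nhds]
    intro ε hε
    obtain ⟨K, hK⟩ := (hwt.eventually_lt_const hε).exists_forall_of_atTop
    rw [Filter.eventually_cofinite]
    refine ((Finset.range K).sigma fun k => (Finset.univ : Finset (Fin (2 ^ N k)))).finite_toSet.subset
      fun i hi => ?_
    simp only [Finset.coe_sigma, Set.mem_sigma_iff, Finset.coe_range, Set.mem_Iio, Finset.coe_univ,
      Set.mem_univ, and_true]
    by_contra! hge
    exact hi ((htp i.1 i.2).2.trans (hK _ hge))
  -- The limit of the atoms lies in E because E is closed; the singular set may contain it.
  have hpE : circlePt p ∈ E := by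
    have h1 : Tendsto (fun k => t k ⟨0, Nat.two_pow_pos _⟩) atTop (𝓝 p) := by
      rw [tendsto_iff_norm_sub_tendsto_zero]
      exact squeeze_zero (fun k => norm_nonneg _) (fun k => (htp k _).2.le) hwt
    exact hE.mem_of_tendsto ((continuous_circlePt.tendsto p).comp h1)
      (Eventually.of_forall fun k => htE k _)
  set m : (Σ k, Fin (2 ^ N k)) → ℝ := fun i => c i.1 * l i.1 / 2 ^ N i.1 with hm
  have hcl0 : ∀ k, 0 ≤ c k * l k := fun k => (mul_pos (hc0 k) (hl0 k)).le
  have hm0 : ∀ i, 0 ≤ m i := fun i => div_nonneg (hcl0 _) (by positivity)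
  have hgeom : ∀ r : ℝ, HasSum (fun k => r * (1 / P k)) r := fun r => by
    convert hasSum_geometric_two' r using 2 with k
    simp only [hP, pow_succ]
    field_simp
  have hms : Summable m := by
    have h1 : Summable fun k => c k * l k :=
      Summable.of_nonneg_of_le hcl0 (fun k => by simpa using hcl k) (hgeom 1).summable
    exact (hasSum_sigma_fin hcl0 h1.hasSum).summable
  obtain ⟨S, hS, hSsing, hSsum⟩ := exists_atomic_singularInner hm0 hms hx1 (norm_circlePt p) hxp
  refine ⟨S, hS, hSsing.trans ?_, fun k => ⟨a k, l k, A k, N k, hl0 k, ?_, ?_, ?_, ?_, ?_⟩⟩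
  · rintro y (rfl | ⟨i, rfl⟩)
    exacts [hpE, htE _ _]
  · linarith [hAκ k, hκ1 k]
  · linarith [hAl k]
  · have h1 := Nat.le_ceil (18 * A k * κ k)
    have h2 := hA0 k
    rw [le_div_iff₀ (by positivity)]
    calc ((k : ℝ) + 1) * (18 * A k) = 18 * A k * κ k := by simp only [hκ]; ring
      _ ≤ _ := h1
  · intro s hs j hj
    have hl1 : l k ≤ 1 / 2 := by
      have := hlw k
      have := hwP k
      have := hPhalf k
      linarith
    have hd := netPt_mem_disc (a := a k) (hl0 k) hl1 s j
    have h1 := le_sum_pker_netPt (hl0 k) hl1 (hc0 k).le (ht k) hs.le hj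
    have h2 := sum_le_hasSum (Finset.univ.map (Function.Embedding.sigmaMk k))
      (fun i _ => mul_nonneg (hm0 i) (pker_pos hd (hx1 i)).le) (hSsum _ hd)
    rw [Finset.sum_map] at h2
    have h3 : c k / 64 = (k : ℝ) + 1 := by simp only [hc, hκ]; ring
    rw [h3] at h1
    exact h1.trans h2
  · intro b hb hbz
    set z : ℂ := ((1 - A k * l k : ℝ) : ℂ) * circlePt (a k) with hz
    have hAl0 : 0 < A k * l k := mul_pos (hA0 k) (hl0 k)
    have hzn : ‖z‖ = 1 - A k * l k := norm_mul_circlePt (by linarith [hAl k]) _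
    have hzd : z ∈ disc := by rw [mem_disc]; linarith
    have hgz1 : A k * l k ≤ gap z := by
      have := one_sub_norm_le_gap (mem_disc.1 hzd).le
      linarith
    have hgz2 : gap z ≤ 2 * (A k * l k) := by
      have := gap_le_two_mul z
      linarith
    have hker : ∀ i, pker z (x i) ≤ 4 / (A k * l k) := fun i =>
      (pker_le_four_div hzd (hx1 i)).trans (by gcongr)
    have hatom : ∀ i : Σ k, Fin (2 ^ N k), c i.1 * l i.1 * pker z (x i) ≤ 1 / κ k * (1 / P i.1) := by
      rintro ⟨j, i⟩
      have hpk := (pker_pos hzd (hx1 ⟨j, i⟩)).le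
      have hkk := hker ⟨j, i⟩
      simp only
      -- Earlier arcs stay at distance d_j from p, against which the k-th arc is tiny, so their
      -- kernels are small. The arc itself is damped by A. Later arcs have mass at most l_k/P_j,
      -- which offsets the crude kernel bound 4/(A·l_k).
      rcases lt_trichotomy j k with hjk | rfl | hkj
      · have h1 : pker z (x ⟨j, i⟩) ≤ 1 / κ k := by
          refine le_trans ?_ (hAw3 k)
          have hak := ((hseq k).2.2.2 _ (ha_mem k)).2.2 j hjk
          exact pker_le_of_far (hA0 k) (hl0 k) (hAl k) (hw0 k).le
            (by linarith [hwP k, hPhalf k]) (by linarith [hAw2 k, hPhalf k]) (hd0 j)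
            (htp j i).1 (by linarith [(htp j i).2, hwP j, hPhalf j]) hak.2 (hld k j hjk)
        calc c j * l j * pker z (x ⟨j, i⟩) ≤ 1 / P j * (1 / κ k) :=
              mul_le_mul (hcl j) h1 hpk (by have := hP0 j; positivity)
          _ = _ := mul_comm _ _
      · calc c j * l j * pker z (x ⟨j, i⟩) ≤ c j * l j * (4 / (A j * l j)) :=
              mul_le_mul_of_nonneg_left hkk (hcl0 j)
          _ = _ := by
            have := hc0 j; have := hκ0 j; have := hP0 j; have := hl0 j
            simp only [hA]
            field_simp
      · have h1 : c j * l j ≤ 1 / P j * l k := by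
          have e1 := hll j k hkj
          have e2 := hcw j
          have e3 := hc0 j
          have e4 := hl0 k
          have e5 := mul_pos (mul_pos e3 (hw0 j)) e4
          have e6 : c j * l j ≤ c j * (2 * (w j * l k)) := by gcongr
          nlinarith
        have h2 : 4 / A k ≤ 1 / κ k := by
          have := hAκ k
          have := hκ0 k
          rw [div_le_div_iff₀ (hA0 k) this]
          linarith
        have h3 := hP0 j
        calc c j * l j * pker z (x ⟨j, i⟩) ≤ 1 / P j * l k * (4 / (A k * l k)) :=
              mul_le_mul h1 hkk hpk (by have := hl0 k; positivity)
          _ = 4 / A k * (1 / P j) := by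
            have := hl0 k; have := hA0 k
            field_simp
          _ ≤ _ := by gcongr
    have hbound := hasSum_sigma_fin (N := N) (v := fun j => 3 / κ k * (1 / P j))
      (fun j => by have := hκ0 k; have := hP0 j; positivity) (hgeom (3 / κ k))
    refine hasSum_le (fun i => ?_) (hSsum b hb) hbound
    have h1 := pker_le_three_mul hzd hb (hx1 i) hbz
    have h2 := hatom i
    calc m i * pker b (x i) ≤ m i * (3 * pker z (x i)) := mul_le_mul_of_nonneg_left h1 (hm0 i)
      _ = 3 * (c i.1 * l i.1 * pker z (x i)) / 2 ^ N i.1 := by simp only [hm]; ring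
      _ ≤ 3 * (1 / κ k * (1 / P i.1)) / 2 ^ N i.1 := by gcongr
      _ = _ := by ring

/-- A closed set for which all singular inner functions are easily wepable is porous. -/
theorem isPorous_of_forall_isEasilyWepable {E : Set ℂ} (hE : IsClosed E)
    (h : ∀ S : ℂ → ℂ, IsSingularInner S → sing S ⊆ E → IsEasilyWepable S) : IsPorous E := by
  by_contra hpor
  obtain ⟨S, hS, hSE, hk⟩ := exists_singularInner_of_not_isPorous hE hpor
  obtain ⟨m, hm1, B, ⟨ι, f, hfd, hfs, hB⟩, hwep, hZ⟩ := h S hS hSE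
  obtain ⟨η, hη, hηle⟩ : ∃ η > 0, ENNReal.ofReal η ≤ etaWEP (fun z => S z * B z) (1 / 8) := by
    have h1 := hwep (1 / 8) (by norm_num)
    obtain ⟨q, hq0, hq⟩ := ENNReal.lt_iff_exists_nnreal_btwn.1 h1
    exact ⟨q, by exact_mod_cast hq0, by simpa using hq.le⟩
  -- The WEP is used at ε = 1/8 < 1/7, so that the non-strict bound on the infimum yields an actual
  -- zero with ρ < 1/7. Since S has no zeros, it is a zero of B.
  have hzero : ∀ z ∈ disc, ‖S z * B z‖ < η → ∃ i, rho z (f i) < 1 / 7 ∧ ‖S (f i)‖ < m := by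
    intro z hz hlt
    have h1 : ¬ ENNReal.ofReal (1 / 8) < rhoSet z (zeroSet fun z => S z * B z) := by
      intro hcon
      have h2 : ENNReal.ofReal η ≤ ENNReal.ofReal ‖S z * B z‖ :=
        hηle.trans (iInf₂_le (f := fun z _ => ENNReal.ofReal ‖S z * B z‖) z ⟨hz, hcon⟩)
      rw [ENNReal.ofReal_le_ofReal_iff (norm_nonneg _)] at h2
      linarith
    have h2 : rhoSet z (zeroSet fun z => S z * B z) < ENNReal.ofReal (1 / 7) :=
      (not_lt.1 h1).trans_lt ((ENNReal.ofReal_lt_ofReal_iff (by norm_num)).2 (by norm_num))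
    simp only [rhoSet, iInf_lt_iff] at h2
    obtain ⟨b, ⟨hbd, hb0⟩, hb⟩ := h2
    have hBb : B b = 0 := (mul_eq_zero.1 hb0).resolve_left (hS.ne_zero hbd)
    obtain ⟨i, rfl⟩ := exists_eq_of_hasProd_zero hfd hfs hbd (hBb ▸ hB b hbd)
    exact ⟨i, (ENNReal.ofReal_lt_ofReal_iff (by norm_num)).1 hb, (hZ ⟨hbd, hBb⟩).2⟩
  -- The constant m may be nonpositive; m' lies in (0, 1), so its logarithm is meaningful and
  -- negative.
  set m' := max m (1 / 2) with hm'
  have hm'0 : 0 < m' := lt_max_of_lt_right (by norm_num)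
  have hm'1 : m' < 1 := max_lt hm1 (by norm_num)
  have hlogm : 0 < -Real.log m' := neg_pos.2 (Real.log_neg hm'0 hm'1)
  obtain ⟨k, hkge⟩ := exists_nat_ge (max (-Real.log η) (3 / -Real.log m'))
  have hk1 : -Real.log η < k + 1 := by linarith [le_max_left (-Real.log η) (3 / -Real.log m')]
  have hk2 : 3 / ((k : ℝ) + 1) < -Real.log m' := by
    have h1 : 3 / -Real.log m' < (k : ℝ) + 1 := by
      linarith [le_max_right (-Real.log η) (3 / -Real.log m')]
    rw [div_lt_iff₀ hlogm] at h1
    rw [div_lt_iff₀ (by positivity)]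
    linarith
  have hexp : Real.exp (-((k : ℝ) + 1)) < η := by
    rw [← Real.lt_log_iff_exp_lt hη]; linarith
  obtain ⟨a, l, A, N, hl0, hA, hAl, hN, hnet, habove⟩ := hk k
  have hl1 : l ≤ 1 / 2 := by nlinarith
  have hAl0 : 0 < A * l := by positivity
  have hzd : ((1 - A * l : ℝ) : ℂ) * circlePt a ∈ disc := by
    rw [mem_disc, norm_mul_circlePt (by linarith)]; linarith
  have hBz : ‖B (((1 - A * l : ℝ) : ℂ) * circlePt a)‖ ≤ Real.exp (-(N / (18 * A))) := by
    refine norm_le_exp_of_net hl0 hA hAl hfd (hB _ hzd) fun s hs j hj => ?_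
    have hwd := netPt_mem_disc (a := a) hl0 hl1 s j
    obtain ⟨i, hi, _⟩ := hzero _ hwd (by
      have h1 := hnet s hs j hj
      have h2 : ‖S (netPt a l s j)‖ ≤ Real.exp (-((k : ℝ) + 1)) := by
        rw [← Real.log_le_iff_le_exp (norm_pos_iff.2 (hS.ne_zero hwd))]
        linarith
      have h3 : ‖B (netPt a l s j)‖ ≤ 1 := by
        simpa using norm_le_prod_rho hfd hwd (hB _ hwd) ∅
      rw [norm_mul]
      nlinarith [norm_nonneg (S (netPt a l s j)), norm_nonneg (B (netPt a l s j))])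
    refine ⟨i, ?_⟩
    have := norm_sub_lt_of_rho_lt hwd (hfd i) hi
    rwa [one_sub_norm_netPt hl0 hl1] at this
  -- B is so small at z_k that the WEP gives a zero there too, at which u ≤ 3/(k + 1) < -log m',
  -- against |S| < m.
  obtain ⟨i, hi, him⟩ := hzero _ hzd (by
    rw [norm_mul]
    have h1 := hS.1.norm_le_one hzd
    have h2 : Real.exp (-(N / (18 * A))) ≤ Real.exp (-((k : ℝ) + 1)) :=
      Real.exp_le_exp.2 (by linarith)
    nlinarith [norm_nonneg (S (((1 - A * l : ℝ) : ℂ) * circlePt a)),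
      norm_nonneg (B (((1 - A * l : ℝ) : ℂ) * circlePt a))])
  have h1 := habove (f i) (hfd i) (by rw [rho_comm]; linarith)
  have h2 : Real.log ‖S (f i)‖ < Real.log m' :=
    Real.log_lt_log (norm_pos_iff.2 (hS.ne_zero (hfd i))) (him.trans_le (le_max_left _ _))
  linarith

end Wepable

theorem theorem2 (E : Set ℂ) (hE : IsClosed E) (hEc : E ⊆ Wepable.unitCircle) :
    (∀ S : ℂ → ℂ, Wepable.IsSingularInner S → Wepable.sing S ⊆ E → Wepable.IsEasilyWepable S) ↔
      Wepable.IsPorous E :=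
  ⟨Wepable.isPorous_of_forall_isEasilyWepable hE, fun h _ hS hSE =>
    hS.isEasilyWepable hEc hSE h⟩
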